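/- Let $(\mathcal S,\mathcal A,P,R,\gamma)$ be a finite discounted Markov decision problem with regret $R:\mathcal S\times\mathcal A\to[0,1]$ and discount factor $\gamma\in(0,1)$. For a stationary policy $\pi=(\pi_s)_{s\in\mathcal S}\in\Pi=\Delta(\mathcal A)^{|\mathcal S|}$ let $V_s(\pi)=\mathbf E[\sum_{t\ge0}\gamma^tR(s_t,a_t)\mid s_0=s]$ and $Q_{s,a}(\pi)=\mathbf E[\sum_{t\ge0}\gamma^tR(s_t,a_t)\mid s_0=s,a_0=a]$, with $a_t\sim\pi_{s_t}$ and $s_{t+1}\sim P(\cdot|s_t,a_t)$. For $\rho\in\Delta(\mathcal S)$ let $V_\rho(\pi)=\sum_s\rho_sV_s(\pi)$, $V_\rho^\star=\inf_{\pi\in\Pi}V_\rho(\pi)$, and $d_{\rho,s'}(\pi)=(1-\gamma)\sum_s\rho_s\sum_{t\ge0}\gamma^t\Pr^\pi(s_t=s'\mid s_0=s)$. Let $\pi^\star\in\Pi$ minimize $V_s$ for every $s$ simultaneously, let $C=\|d_\rho(\pi^\star)/\rho\|_\infty=\max_s d_{\rho,s}(\pi^\star)/\rho_s$ (with $0/0=1$),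 assume $C<\infty$ (for example $\rho>0$), and put $\vartheta_\rho=C/(1-\gamma)$. Let $h$ be a convex function on a convex set $\operatorname{dom}h\subseteq\mathbf R^{|\mathcal A|}$, of Legendre type: differentiable and strictly convex in the interior of $\operatorname{dom} h$, with $\|\nabla h(x)\|\to\infty$ as $x$ tends, from the interior, to any boundary point of $\operatorname{dom} h$. Assume that $\Delta(\mathcal A)\subseteq\operatorname{dom}h$ and that $\Delta(\mathcal A)$ meets the interior of $\operatorname{dom}h$, and let $D(p,p')=h(p)-h(p')-\langle\nabla h(p'),p-p'\rangle$. Inexact policy mirror descent starts from a policy $\pi^{(0)}$ with all $\pi^{(0)}_{s,a}>0$ and iterates $$\pi^{(k+1)}_s=\operatorname*{arg\,min}_{p\in\Delta(\mathcal A)}\Bigl\{\eta_k\langle\widehat Q^{(k)}_s,p\rangle+D(p,\pi^{(k)}_s)\Bigr\},\qquad s\in\mathcal S,$$ with $\eta_0>0$, $\eta_0\ge\frac{1-\gamma}{\gamma}\sum_sd_{\rho,s}(\pi^\star)D(\pi^\star_s,\pi^{(0)}_s)$ and $\eta_{k+1}\ge\eta_k/\gamma$ for all $k\ge 0$. Under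 the generative model, in iteration $k$, given the past, one draws for every $(s,a)$ a batch of $M_k$ independent trajectories $(s_0^{(i)},a_0^{(i)}),\dots,(s_{H-1}^{(i)},a_{H-1}^{(i)})$ of the policy $\pi^{(k)}$ with $s_0^{(i)}=s$, $a_0^{(i)}=a$, and sets $\widehat Q^{(k)}_{s,a}=\frac1{M_k}\sum_{i=1}^{M_k}\sum_{t=0}^{H-1}\gamma^tR(s^{(i)}_t,a^{(i)}_t)$; no independence between different pairs $(s,a)$ is required. The number of sampled state-action pairs in $K$ iterations is $\sum_{k<K}|\mathcal S||\mathcal A|M_kH$. Let $\delta\in(0,1)$. 1. For all integers $K,H>0$, if $M_k\ge\frac{\gamma^{-2H}}2\log\frac{2K|\mathcal S||\mathcal A|}\delta$ for $k=0,\dots,K-1$, then with probability at least $1-\delta$ $$V_\rho(\pi^{(K)})-V_\rho^\star\le\Bigl(1-\frac1{\vartheta_\rho}\Bigr)^K\frac2{1-\gamma}+\frac{8\vartheta_\rho}{(1-\gamma)^2}\gamma^H .$$ 2. If moreover $\epsilon>0$, $K\ge\vartheta_\rho\log\frac4{(1-\gamma)\epsilon}$ and $H\ge\frac1{1-\gamma}\log\frac{16\vartheta_\rho}{(1-\gamma)^2\epsilon}$,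 then $V_\rho(\pi^{(K)})-V_\rho^\star\le\epsilon$ with probability at least $1-\delta$. 3. There are universal constants $c>0$ and $p\in\mathbf N$ (independent of the decision problem, of $\rho,h,\pi^{(0)},(\eta_k)$, and of $\delta,\epsilon$) such that the following holds for $0<\epsilon\le\frac1{1-\gamma}$. Write $\Lambda=1+\log\frac1{1-\gamma}+\max\{\log\frac1\epsilon,0\}+\log\frac{|\mathcal S||\mathcal A|}\delta+\log C$. (a) With $K=\lceil\vartheta_\rho\log\frac4{(1-\gamma)\epsilon}\rceil$, $H=\lceil\frac1{1-\gamma}\log\frac{16\vartheta_\rho}{(1-\gamma)^2\epsilon}\rceil$ and $M_k=\bigl\lceil\frac12\bigl(\frac{16\vartheta_\rho}{(1-\gamma)^2\epsilon}\bigr)^2\log\frac{2K|\mathcal S||\mathcal A|}\delta\bigr\rceil$ for all $k$, one has $V_\rho(\pi^{(K)})-V_\rho^\star\le\epsilon$ with probability at least $1-\delta$, and the number of sampled state-action pairs is at most $$c\,\Lambda^p\,\frac{|\mathcal S||\mathcal A|}{(1-\gamma)^8\epsilon^2}\Bigl\|\frac{d_\rho(\pi^\star)}\rho\Bigr\|_\infty^3=\widetilde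 O\Bigl(\frac{|\mathcal S||\mathcal A|}{(1-\gamma)^8\epsilon^2}\Bigl\|\frac{d_\rho(\pi^\star)}\rho\Bigr\|_\infty^3\Bigr).$$ (b) With the same $K$, with $H=\bigl\lceil\frac1{\log(1/\gamma)}\log\frac{16\vartheta_\rho}{(1-\gamma)^2\epsilon}\bigr\rceil$ and with the batch sizes $M_k=\bigl\lceil\frac{\gamma^{-2H}}2\log\frac{2K|\mathcal S||\mathcal A|}\delta\bigr\rceil$ of part 1, one again has $V_\rho(\pi^{(K)})-V_\rho^\star\le\epsilon$ with probability at least $1-\delta$, and the number of sampled state-action pairs is at most $\gamma^{-2}$ times the bound in (a). -/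

import Mathlib

open MeasureTheory ProbabilityTheory Set Filter
open scoped Topology ENNReal

universe u v w

noncomputable section

/-- A finite discounted Markov decision problem: transition probabilities `P s a s'` (the
probability of moving to `s'` when action `a` is taken in state `s`), a regret (cost) function
with values in `[0,1]`, and a discount factor in `[0,1)`. -/
structure DMDP (S : Type u) (A : Type v) [Fintype S] [Fintype A] where
  P : S → A → S → ℝ
  P_nonneg : ∀ s a s', 0 ≤ P s a s'
  P_sum : ∀ s a, ∑ s', P s a s' = 1
  R : S → A → ℝ
  R_nonneg : ∀ s a, 0 ≤ R s a
  R_le_one : ∀ s a, R s a ≤ 1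
  γ : ℝ
  γ_nonneg : 0 ≤ γ
  γ_lt_one : γ < 1

/-- The set of stationary policies, the product of `|S|` copies of the simplex over `A`. -/
def policies (S : Type u) (A : Type v) [Fintype A] : Set (S → A → ℝ) :=
  {π | ∀ s, π s ∈ stdSimplex ℝ A}

/-- The relative interior of the set of policies: all action probabilities are positive. -/
def policiesInterior (S : Type u) (A : Type v) [Fintype A] : Set (S → A → ℝ) :=
  {π | π ∈ policies S A ∧ ∀ s a, 0 < π s a}

namespace DMDP

variable {S : Type u} {A : Type v} [Fintype S] [Fintype A]

/-- Probability that the first `n` state-action pairs of the trajectory are `τ`, when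
`(s₀,a₀) ∼ ν`, `s_{t+1} ∼ P(· ∣ s_t, a_t)` and `a_{t+1} ∼ π(s_{t+1})`. -/
def pathProb (m : DMDP S A) (π : S → A → ℝ) (ν : S × A → ℝ) {n : ℕ} (τ : Fin n → S × A) : ℝ :=
  ∏ t : Fin n,
    if _h : (t : ℕ) = 0 then ν (τ t)
    else
      m.P (τ ⟨(t : ℕ) - 1, by omega⟩).1 (τ ⟨(t : ℕ) - 1, by omega⟩).2 (τ t).1
        * π (τ t).1 (τ t).2

/-- `E[f(s_t, a_t)]` for the trajectory of policy `π` with `(s₀,a₀) ∼ ν`. -/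
def expectAt (m : DMDP S A) (π : S → A → ℝ) (ν : S × A → ℝ) (t : ℕ) (f : S × A → ℝ) : ℝ :=
  ∑ τ : Fin (t + 1) → S × A, m.pathProb π ν τ * f (τ (Fin.last t))

/-- The expected discounted total regret `E[∑_t γ^t R(s_t, a_t)]` with `(s₀,a₀) ∼ ν`. -/
def expectedReturn (m : DMDP S A) (π : S → A → ℝ) (ν : S × A → ℝ) : ℝ :=
  ∑' t : ℕ, m.γ ^ t * m.expectAt π ν t (fun x => m.R x.1 x.2)

open Classical in
/-- The law of `(s₀,a₀)` when `s₀ = s` and `a₀ ∼ π(s)`. -/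
def startState (π : S → A → ℝ) (s : S) : S × A → ℝ :=
  fun x => if x.1 = s then π s x.2 else 0

open Classical in
/-- The law of `(s₀,a₀)` when `s₀ = s` and `a₀ = a`. -/
def startPair (s : S) (a : A) : S × A → ℝ :=
  fun x => if x = (s, a) then 1 else 0

/-- The value `V_s(π)`. -/
def V (m : DMDP S A) (π : S → A → ℝ) (s : S) : ℝ :=
  m.expectedReturn π (startState π s)

/-- The state-action value `Q_{s,a}(π)`. -/
def Q (m : DMDP S A) (π : S → A → ℝ) (s : S) (a : A) : ℝ :=
  m.expectedReturn π (startPair s a)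

/-- The weighted value `V_ρ(π) = E_{s ∼ ρ} V_s(π)`. -/
def Vw (m : DMDP S A) (ρ : S → ℝ) (π : S → A → ℝ) : ℝ :=
  ∑ s, ρ s * m.V π s

/-- The optimal weighted value `V_ρ^⋆`. -/
def VwOpt (m : DMDP S A) (ρ : S → ℝ) : ℝ :=
  sInf (m.Vw ρ '' policies S A)

/-- A stationary policy that minimizes `V_s` for all states `s` simultaneously. -/
def IsOptimal (m : DMDP S A) (π : S → A → ℝ) : Prop :=
  π ∈ policies S A ∧ ∀ π' ∈ policies S A, ∀ s, m.V π s ≤ m.V π' s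

open Classical in
/-- `Pr^π(s_t = s' ∣ s₀ = s)`. -/
def stateProb (m : DMDP S A) (π : S → A → ℝ) (t : ℕ) (s s' : S) : ℝ :=
  m.expectAt π (startState π s) t (fun x => if x.1 = s' then 1 else 0)

/-- The discounted state-visitation distribution `d_{s,s'}(π)`. -/
def visit (m : DMDP S A) (π : S → A → ℝ) (s s' : S) : ℝ :=
  (1 - m.γ) * ∑' t : ℕ, m.γ ^ t * m.stateProb π t s s'

/-- The discounted state-visitation distribution `d_ρ(π)`. -/
def visitw (m : DMDP S A) (ρ : S → ℝ) (π : S → A → ℝ) (s' : S) : ℝ :=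
  ∑ s, ρ s * m.visit π s s'

end DMDP

open Classical in
/-- The distribution mismatch `‖p/q‖_∞ = max_s p_s/q_s` in `[0,∞]`, with `0/0 = 1`. -/
def mismatch {S : Type u} (p q : S → ℝ) : ℝ≥0∞ :=
  ⨆ s, if p s = 0 ∧ q s = 0 then 1 else ENNReal.ofReal (p s) / ENNReal.ofReal (q s)

/-- `h` with effective domain `Z` is a convex function of Legendre type: strictly convex and
differentiable in the interior of the domain, with gradients whose norms tend to infinity at the
boundary of the domain. -/
structure IsLegendre {A : Type v} [Fintype A] (h : (A → ℝ) → ℝ) (Z : Set (A → ℝ)) : Prop where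
  convexOn : ConvexOn ℝ Z h
  strictConvexOn : StrictConvexOn ℝ (interior Z) h
  differentiableAt : ∀ x ∈ interior Z, DifferentiableAt ℝ h x
  steep : ∀ x ∈ frontier Z, Tendsto (fun y => ‖fderiv ℝ h y‖) (𝓝[interior Z] x) atTop

/-- The Bregman divergence `D(p,q) = h(p) - h(q) - ⟨∇h(q), p - q⟩`. -/
def bregman {A : Type v} [Fintype A] (h : (A → ℝ) → ℝ) (p q : A → ℝ) : ℝ :=
  h p - h q - fderiv ℝ h q (p - q)

/-- The weighted divergence `D_w(π,π') = ∑_s w_s D(π_s,π'_s)`. -/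
def bregmanw {S : Type u} {A : Type v} [Fintype S] [Fintype A] (h : (A → ℝ) → ℝ) (wt : S → ℝ)
    (π π' : S → A → ℝ) : ℝ :=
  ∑ s, wt s * bregman h (π s) (π' s)

namespace DMDP

variable {S : Type u} {A : Type v} [Fintype S] [Fintype A]

/-- The Monte-Carlo estimate of one entry of the `Q`-function from `M` trajectories of
horizon `H`: the average of the truncated discounted returns. -/
def qHat (m : DMDP S A) {M H : ℕ} (T : Fin M → Fin H → S × A) : ℝ :=
  (1 / (M : ℝ)) * ∑ i, ∑ t : Fin H, m.γ ^ (t : ℕ) * m.R (T i t).1 (T i t).2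

/-- A run of `K` iterations of inexact policy mirror descent under a generative model.
`ℱ k` is the information available before the `k`-th batch is drawn, `T k s a i` is the `i`-th
trajectory of that batch started in `(s,a)`, and `π k` is the `k`-th policy. -/
structure IsInexactPMDRun (m : DMDP S A) (h : (A → ℝ) → ℝ) (η : ℕ → ℝ) (π₀ : S → A → ℝ)
    (K H : ℕ) (M : ℕ → ℕ) {Ω : Type w} [mΩ : MeasurableSpace Ω] (μ : Measure Ω)
    (ℱ : Filtration ℕ mΩ) (T : (k : ℕ) → S → A → Fin (M k) → Ω → (Fin H → S × A))
    (π : ℕ → Ω → S → A → ℝ) : Prop where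
  /-- The method starts from the given policy. -/
  init : ∀ ω, π 0 ω = π₀
  /-- The `k`-th policy is determined by the information available before the `k`-th batch. -/
  policy_adapted : ∀ k ≤ K, ∀ s a, Measurable[ℱ k] (fun ω => π k ω s a)
  /-- The `k`-th batch is known after it has been drawn. -/
  batch_adapted : ∀ k < K, ∀ s a i τ, MeasurableSet[ℱ (k + 1)] {ω | T k s a i ω = τ}
  /-- Given the past, for each `(s,a)` the trajectories `T k s a 0, T k s a 1, …` are independent
  and each of them is a trajectory of policy `π k` with `s₀ = s` and `a₀ = a`. -/
  batch_law : ∀ k < K, ∀ s a, ∀ τ : Fin (M k) → (Fin H → S × A),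
    μ[({ω | ∀ i, T k s a i ω = τ i}).indicator (fun _ => (1 : ℝ)) | ℱ k]
      =ᵐ[μ] fun ω => ∏ i, m.pathProb (π k ω) (startPair s a) (τ i)
  /-- The mirror descent step with the estimated `Q`-function. -/
  step_mem : ∀ k < K, ∀ ω s, π (k + 1) ω s ∈ stdSimplex ℝ A
  step_min : ∀ k < K, ∀ ω s,
    IsMinOn (fun p : A → ℝ =>
        η k * ∑ a, m.qHat (fun i => T k s a i ω) * p a + bregman h p (π k ω s))
      (stdSimplex ℝ A) (π (k + 1) ω s)

/-- With probability at least `1 - δ`, the last policy of a run of `K` iterations with horizon `H`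
and batch sizes `M` satisfies `V_ρ(π_K) - V_ρ^⋆ ≤ b`, whatever the underlying probability space. -/
def Guarantee (m : DMDP S A) (h : (A → ℝ) → ℝ) (η : ℕ → ℝ) (π₀ : S → A → ℝ) (ρ : S → ℝ)
    (K H : ℕ) (M : ℕ → ℕ) (δ b : ℝ) : Prop :=
  ∀ (Ω : Type w) [mΩ : MeasurableSpace Ω] (μ : Measure Ω) [IsProbabilityMeasure μ]
    (ℱ : Filtration ℕ mΩ) (T : (k : ℕ) → S → A → Fin (M k) → Ω → (Fin H → S × A))
    (π : ℕ → Ω → S → A → ℝ),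
    m.IsInexactPMDRun h η π₀ K H M μ ℱ T π →
      1 - δ ≤ μ.real {ω | m.Vw ρ (π K ω) - m.VwOpt ρ ≤ b}

end DMDP

/-- The number of sampled state-action pairs: in each of `K` iterations, `M k` trajectories of
horizon `H` for every state-action pair. -/
def sampleCount (S : Type u) (A : Type v) [Fintype S] [Fintype A] (K H : ℕ) (M : ℕ → ℕ) : ℕ :=
  ∑ k ∈ Finset.range K, Fintype.card S * Fintype.card A * M k * H

end

/-! The run is analysed through the potential `Φ k`: the value gap of the `k`-th policy plus its
Bregman distance to the optimal policy, weighted by `d_ρ(π⋆)` and divided by `(1-γ) η_k (θ-1)`. If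
all estimated `Q`-functions are within `τ` of the true ones, `Φ - E` contracts by the factor `1 -
1/θ` at each step, where `E = 4θτ/(1-γ)`.

The contraction (`inexact_step`, `inexact_pmd_bound`) comes from the three-point inequality of the
mirror step. Tested against the current policy, it shows that the estimated improvement is
nonpositive in every state; this sign permits replacing `d_ρ(π⋆)` by the larger weight `θ
d_ρ(π_{k+1})`, and `performance_difference` then yields a difference of values. Tested against `π⋆`,
it makes the Bregman terms telescope. The growth `η_{k+1} ≥ η_k/γ` together with `θ(1-γ) ≥ 1` keeps
the weights compatible from one step to the next. Steepness of the Legendre function keeps all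
iterates in the interior of its domain, where these inequalities hold.

The accuracy `τ` is the sum of the truncation bias `γ^H/(1-γ)` and a sampling error `1/(X(1-γ))`.
The latter is controlled by a conditional Hoeffding inequality (`measureReal_deviation_le`) and a
union bound over the `K|S||A|` estimates, which needs no independence between pairs. Taking `X =
γ^{-H}` or `X = 16θ/((1-γ)²ε)` gives the two choices of batch size. -/

namespace DMDP

/-! ### Trajectories, Bellman equations, visitation distributions and truncated returns -/

section Trajectory

variable {S : Type u} {A : Type v} [Fintype S] [Fintype A]

/-- The transition operator of the state process under a policy. -/
noncomputable def transitionOp (m : DMDP S A) (π : S → A → ℝ) : Module.End ℝ (S → ℝ) where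
  toFun u s := ∑ a, π s a * ∑ s', m.P s a s' * u s'
  map_add' u v := by
    funext s
    simp [mul_add, Finset.sum_add_distrib]
  map_smul' c u := by
    funext s
    simp only [Pi.smul_apply, smul_eq_mul, RingHom.id_apply, Finset.mul_sum]
    exact Finset.sum_congr rfl fun a _ => Finset.sum_congr rfl fun s' _ => by ring

lemma transitionOp_apply (m : DMDP S A) (π : S → A → ℝ) (u : S → ℝ) (s : S) :
    m.transitionOp π u s = ∑ a, π s a * ∑ s', m.P s a s' * u s' := rfl

/-- The average of a function of state-action pairs over the actions of a policy. -/
def actionMean (π : S → A → ℝ) (f : S × A → ℝ) (s : S) : ℝ := ∑ a, π s a * f (s, a)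

lemma transitionOp_pow_nonneg (m : DMDP S A) {π : S → A → ℝ} (hπ : π ∈ policies S A)
    {u : S → ℝ} (hu : ∀ s, 0 ≤ u s) (t : ℕ) (s : S) : 0 ≤ (m.transitionOp π ^ t) u s := by
  induction t generalizing s with
  | zero => simpa using hu s
  | succ t ih =>
    rw [pow_succ', Module.End.mul_apply, transitionOp_apply]
    exact Finset.sum_nonneg fun a _ => mul_nonneg ((hπ s).1 a)
      (Finset.sum_nonneg fun s' _ => mul_nonneg (m.P_nonneg _ _ _) (ih s'))

lemma transitionOp_const (m : DMDP S A) {π : S → A → ℝ} (hπ : π ∈ policies S A) (c : ℝ) :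
    m.transitionOp π (fun _ => c) = fun _ => c := by
  funext s
  simp only [transitionOp_apply, ← Finset.sum_mul, m.P_sum, one_mul, (hπ s).2]

lemma transitionOp_pow_const (m : DMDP S A) {π : S → A → ℝ} (hπ : π ∈ policies S A) (c : ℝ)
    (t : ℕ) : (m.transitionOp π ^ t) (fun _ => c) = fun _ => c := by
  induction t with
  | zero => rfl
  | succ t ih => rw [pow_succ, Module.End.mul_apply, transitionOp_const m hπ, ih]

lemma transitionOp_pow_le (m : DMDP S A) {π : S → A → ℝ} (hπ : π ∈ policies S A)
    {u : S → ℝ} {c : ℝ} (hu : ∀ s, u s ≤ c) (t : ℕ) (s : S) :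
    (m.transitionOp π ^ t) u s ≤ c := by
  have h := m.transitionOp_pow_nonneg hπ (u := (fun _ => c) - u)
    (fun s => sub_nonneg.2 (hu s)) t s
  rw [map_sub, m.transitionOp_pow_const hπ] at h
  exact sub_nonneg.1 h

lemma transitionOp_pow_abs_le (m : DMDP S A) {π : S → A → ℝ} (hπ : π ∈ policies S A)
    {u : S → ℝ} {c : ℝ} (hu : ∀ s, |u s| ≤ c) (t : ℕ) (s : S) :
    |(m.transitionOp π ^ t) u s| ≤ c := by
  have h := m.transitionOp_pow_le hπ (u := -u) (c := c) (fun s => (neg_le_abs _).trans (hu s)) t s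
  rw [map_neg, Pi.neg_apply] at h
  exact abs_le.2 ⟨by linarith, m.transitionOp_pow_le hπ (fun s => (le_abs_self _).trans (hu s)) t s⟩

lemma summable_discount_mul (m : DMDP S A) {x : ℕ → ℝ} {c : ℝ} (hx : ∀ t, |x t| ≤ c) :
    Summable fun t => m.γ ^ t * x t := by
  refine Summable.of_norm_bounded
    ((summable_geometric_of_lt_one m.γ_nonneg m.γ_lt_one).mul_right c) fun t => ?_
  rw [norm_mul, Real.norm_eq_abs, Real.norm_eq_abs, abs_of_nonneg (pow_nonneg m.γ_nonneg t)]
  exact mul_le_mul_of_nonneg_left (hx t) (pow_nonneg m.γ_nonneg t)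

lemma exists_abs_le (u : S → ℝ) : ∃ c, ∀ s, |u s| ≤ c :=
  ⟨∑ s, |u s|, fun s => Finset.single_le_sum (f := fun s => |u s|) (fun _ _ => abs_nonneg _)
    (Finset.mem_univ s)⟩

lemma summable_transitionOp (m : DMDP S A) {π : S → A → ℝ} (hπ : π ∈ policies S A)
    (u : S → ℝ) (s : S) : Summable fun t => m.γ ^ t * (m.transitionOp π ^ t) u s := by
  obtain ⟨c, hc⟩ := exists_abs_le u
  exact m.summable_discount_mul fun t => m.transitionOp_pow_abs_le hπ hc t s

/-- The solution of `u = g + γ L u` is the discounted sum of `g` along the state process. -/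
lemma hasSum_of_bellman (m : DMDP S A) {π : S → A → ℝ} (hπ : π ∈ policies S A)
    {u g : S → ℝ} (h : ∀ s, u s = g s + m.γ * m.transitionOp π u s) (s : S) :
    HasSum (fun t => m.γ ^ t * (m.transitionOp π ^ t) g s) (u s) := by
  have hs := (m.summable_transitionOp hπ u s).hasSum
  -- The series for `u` minus its shift telescopes: its sum is the zeroth term `u s`, and its terms
  -- are `γ^t L^t (u - γ L u)`.
  have hs' := (hasSum_nat_add_iff' 1).2 hs
  have hg : g = u - m.γ • m.transitionOp π u := by
    funext s; simp [h s]
  have := hs.sub hs'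
  simp only [Finset.range_one, Finset.sum_singleton, pow_zero, one_mul, sub_sub_cancel,
    Module.End.one_apply] at this
  refine this.congr_fun ?_
  intro t
  rw [hg, map_sub, map_smul, Pi.sub_apply, Pi.smul_apply, smul_eq_mul, pow_succ (m.transitionOp π),
    Module.End.mul_apply]
  ring

/-- Each factor of `pathProb` looks only one step back, so inductions on the length peel off the
last pair. -/
lemma pathProb_snoc (m : DMDP S A) (π : S → A → ℝ) (ν : S × A → ℝ) {n : ℕ}
    (τ : Fin (n + 1) → S × A) (y : S × A) :
    m.pathProb π ν (Fin.snoc τ y : Fin (n + 2) → S × A)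
      = m.pathProb π ν τ * (m.P (τ (Fin.last n)).1 (τ (Fin.last n)).2 y.1 * π y.1 y.2) := by
  unfold pathProb
  rw [Fin.prod_univ_castSucc]
  congr 1
  · refine Finset.prod_congr rfl fun t _ => ?_
    have h1 : (Fin.snoc τ y : Fin (n + 2) → S × A) t.castSucc = τ t := by simp
    have h2 : (Fin.snoc τ y : Fin (n + 2) → S × A) ⟨(t.castSucc : ℕ) - 1, by omega⟩
        = τ ⟨(t : ℕ) - 1, by omega⟩ := by
      rw [← Fin.snoc_castSucc (α := fun _ => S × A) (x := y) (p := τ)]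
      rfl
    rw [h1, h2]
    rfl
  · have h2 : (Fin.snoc τ y : Fin (n + 2) → S × A)
        ⟨((Fin.last (n + 1) : Fin (n + 2)) : ℕ) - 1, by simp⟩ = τ (Fin.last n) := by
      rw [← Fin.snoc_castSucc (α := fun _ => S × A) (x := y) (p := τ)]
      rfl
    rw [dif_neg (by simp), h2, Fin.snoc_last]

lemma sum_fin_snoc {X : Type*} [Fintype X] {n : ℕ} (F : (Fin (n + 1) → X) → ℝ) :
    ∑ τ, F τ = ∑ τ : Fin n → X, ∑ y, F (Fin.snoc τ y) := by
  rw [← (Fin.snocEquiv fun _ => X).sum_comp, Fintype.sum_prod_type, Finset.sum_comm]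
  rfl

lemma sum_fin_one {X : Type*} [Fintype X] (F : (Fin 1 → X) → ℝ) :
    ∑ τ, F τ = ∑ x, F (fun _ => x) :=
  ((Equiv.funUnique (Fin 1) X).symm.sum_comp F).symm

lemma pathProb_one (m : DMDP S A) (π : S → A → ℝ) (ν : S × A → ℝ) (τ : Fin 1 → S × A) :
    m.pathProb π ν τ = ν (τ 0) := by
  simp [pathProb]

lemma expectAt_zero (m : DMDP S A) (π : S → A → ℝ) (ν f : S × A → ℝ) :
    m.expectAt π ν 0 f = ∑ x, ν x * f x := by
  unfold expectAt
  rw [sum_fin_one]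
  simp [pathProb_one]

lemma expectAt_succ (m : DMDP S A) (π : S → A → ℝ) (ν : S × A → ℝ) (t : ℕ) (f : S × A → ℝ) :
    m.expectAt π ν (t + 1) f
      = m.expectAt π ν t (fun x => ∑ s', m.P x.1 x.2 s' * actionMean π f s') := by
  unfold expectAt
  rw [sum_fin_snoc]
  refine Finset.sum_congr rfl fun τ _ => ?_
  simp only [pathProb_snoc, Fin.snoc_last, Fintype.sum_prod_type, actionMean, Finset.mul_sum]
  exact Finset.sum_congr rfl fun s _ => Finset.sum_congr rfl fun a _ => by ring

lemma actionMean_transition (m : DMDP S A) (π : S → A → ℝ) (u : S → ℝ) :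
    actionMean π (fun x => ∑ s', m.P x.1 x.2 s' * u s') = m.transitionOp π u := rfl

/-- The law of the pair after `t + 1` steps, as an expectation over the initial pair. -/
lemma expectAt_succ_eq (m : DMDP S A) (π : S → A → ℝ) (ν : S × A → ℝ) (t : ℕ)
    (f : S × A → ℝ) :
    m.expectAt π ν (t + 1) f
      = ∑ x, ν x * ∑ s', m.P x.1 x.2 s' * (m.transitionOp π ^ t) (actionMean π f) s' := by
  induction t generalizing f with
  | zero => rw [expectAt_succ, expectAt_zero]; rfl
  | succ t ih =>
    rw [expectAt_succ, ih, actionMean_transition, pow_succ]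
    rfl

lemma sum_startState_mul (π : S → A → ℝ) (s : S) (f : S × A → ℝ) :
    ∑ x, startState π s x * f x = actionMean π f s := by
  classical
  simp [startState, Fintype.sum_prod_type, actionMean, ite_mul, Finset.sum_ite_irrel]

lemma sum_startPair_mul (s : S) (a : A) (f : S × A → ℝ) :
    ∑ x, startPair s a x * f x = f (s, a) := by
  classical
  simp [startPair]

/-- Since the first action is also drawn from `π`, averaging over actions turns the pair process
into the state process, and discounted sums become Neumann series of `transitionOp`. -/
lemma expectAt_startState (m : DMDP S A) (π : S → A → ℝ) (s : S) (t : ℕ) (f : S × A → ℝ) :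
    m.expectAt π (startState π s) t f = (m.transitionOp π ^ t) (actionMean π f) s := by
  cases t with
  | zero => rw [expectAt_zero, sum_startState_mul]; rfl
  | succ t => rw [expectAt_succ_eq, sum_startState_mul, actionMean_transition, pow_succ']; rfl

lemma expectAt_startPair_succ (m : DMDP S A) (π : S → A → ℝ) (s : S) (a : A) (t : ℕ)
    (f : S × A → ℝ) :
    m.expectAt π (startPair s a) (t + 1) f
      = ∑ s', m.P s a s' * m.expectAt π (startState π s') t f := by
  simp only [expectAt_startState]
  rw [expectAt_succ_eq, sum_startPair_mul]

lemma expectAt_startPair_zero (m : DMDP S A) (π : S → A → ℝ) (s : S) (a : A)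
    (f : S × A → ℝ) : m.expectAt π (startPair s a) 0 f = f (s, a) := by
  rw [expectAt_zero, sum_startPair_mul]

omit [Fintype S] in
lemma actionMean_nonneg {π : S → A → ℝ} (hπ : π ∈ policies S A) {f : S × A → ℝ}
    (hf : ∀ x, 0 ≤ f x) (s : S) : 0 ≤ actionMean π f s :=
  Finset.sum_nonneg fun a _ => mul_nonneg ((hπ s).1 a) (hf _)

omit [Fintype S] in
lemma actionMean_le {π : S → A → ℝ} (hπ : π ∈ policies S A) {f : S × A → ℝ} {c : ℝ}
    (hf : ∀ x, f x ≤ c) (s : S) : actionMean π f s ≤ c :=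
  calc actionMean π f s ≤ ∑ a, π s a * c :=
        Finset.sum_le_sum fun a _ => mul_le_mul_of_nonneg_left (hf _) ((hπ s).1 a)
    _ = c := by rw [← Finset.sum_mul, (hπ s).2, one_mul]

lemma expectAt_startState_mem (m : DMDP S A) {π : S → A → ℝ} (hπ : π ∈ policies S A) (s : S)
    (t : ℕ) {f : S × A → ℝ} (h0 : ∀ x, 0 ≤ f x) (h1 : ∀ x, f x ≤ 1) :
    m.expectAt π (startState π s) t f ∈ Icc (0 : ℝ) 1 := by
  rw [expectAt_startState]
  exact ⟨m.transitionOp_pow_nonneg hπ (actionMean_nonneg hπ h0) t s,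
    m.transitionOp_pow_le hπ (actionMean_le hπ h1) t s⟩

lemma expectAt_startPair_mem (m : DMDP S A) {π : S → A → ℝ} (hπ : π ∈ policies S A) (s : S)
    (a : A) (t : ℕ) {f : S × A → ℝ} (h0 : ∀ x, 0 ≤ f x) (h1 : ∀ x, f x ≤ 1) :
    m.expectAt π (startPair s a) t f ∈ Icc (0 : ℝ) 1 := by
  cases t with
  | zero => rw [expectAt_startPair_zero]; exact ⟨h0 _, h1 _⟩
  | succ t =>
    rw [expectAt_startPair_succ]
    have h := fun s' => m.expectAt_startState_mem hπ s' t h0 h1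
    refine ⟨Finset.sum_nonneg fun s' _ => mul_nonneg (m.P_nonneg _ _ _) (h s').1, ?_⟩
    calc _ ≤ ∑ s', m.P s a s' * 1 :=
          Finset.sum_le_sum fun s' _ => mul_le_mul_of_nonneg_left (h s').2 (m.P_nonneg _ _ _)
      _ = 1 := by rw [← Finset.sum_mul, m.P_sum, one_mul]

/-- The regret as a function of state-action pairs. -/
def regret (m : DMDP S A) (x : S × A) : ℝ := m.R x.1 x.2

lemma summable_V (m : DMDP S A) {π : S → A → ℝ} (hπ : π ∈ policies S A) (s : S) :
    Summable fun t => m.γ ^ t * m.expectAt π (startState π s) t m.regret :=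
  m.summable_discount_mul (c := 1) fun t => by
    have h := m.expectAt_startState_mem hπ s t (f := m.regret)
      (fun _ => m.R_nonneg _ _) (fun _ => m.R_le_one _ _)
    rw [abs_of_nonneg h.1]; exact h.2

lemma summable_Q (m : DMDP S A) {π : S → A → ℝ} (hπ : π ∈ policies S A) (s : S) (a : A) :
    Summable fun t => m.γ ^ t * m.expectAt π (startPair s a) t m.regret :=
  m.summable_discount_mul (c := 1) fun t => by
    have h := m.expectAt_startPair_mem hπ s a t (f := m.regret)
      (fun _ => m.R_nonneg _ _) (fun _ => m.R_le_one _ _)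
    rw [abs_of_nonneg h.1]; exact h.2

lemma V_eq (m : DMDP S A) (π : S → A → ℝ) (s : S) :
    m.V π s = ∑' t, m.γ ^ t * m.expectAt π (startState π s) t m.regret := rfl

lemma Q_eq (m : DMDP S A) (π : S → A → ℝ) (s : S) (a : A) :
    m.Q π s a = ∑' t, m.γ ^ t * m.expectAt π (startPair s a) t m.regret := rfl

lemma V_nonneg (m : DMDP S A) {π : S → A → ℝ} (hπ : π ∈ policies S A) (s : S) :
    0 ≤ m.V π s :=
  tsum_nonneg fun t => mul_nonneg (pow_nonneg m.γ_nonneg t)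
    (m.expectAt_startState_mem hπ s t (f := m.regret)
      (fun _ => m.R_nonneg _ _) (fun _ => m.R_le_one _ _)).1

lemma V_le (m : DMDP S A) {π : S → A → ℝ} (hπ : π ∈ policies S A) (s : S) :
    m.V π s ≤ 1 / (1 - m.γ) := by
  rw [V_eq, one_div, ← tsum_geometric_of_lt_one m.γ_nonneg m.γ_lt_one]
  refine (m.summable_V hπ s).tsum_le_tsum (fun t => ?_)
    (summable_geometric_of_lt_one m.γ_nonneg m.γ_lt_one)
  exact mul_le_of_le_one_right (pow_nonneg m.γ_nonneg t)
    (m.expectAt_startState_mem hπ s t (f := m.regret)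
      (fun _ => m.R_nonneg _ _) (fun _ => m.R_le_one _ _)).2

/-- The Bellman equation expressing `Q` through `V`. -/
lemma Q_eq_R_add (m : DMDP S A) {π : S → A → ℝ} (hπ : π ∈ policies S A) (s : S) (a : A) :
    m.Q π s a = m.R s a + m.γ * ∑ s', m.P s a s' * m.V π s' := by
  rw [Q_eq, (m.summable_Q hπ s a).tsum_eq_zero_add]
  congr 1
  · simp [expectAt_startPair_zero, regret]
  · have h1 : HasSum (fun t => ∑ s', m.P s a s' *
        (m.γ ^ t * m.expectAt π (startState π s') t m.regret)) (∑ s', m.P s a s' * m.V π s') :=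
      hasSum_sum fun s' _ => (m.summable_V hπ s').hasSum.mul_left _
    rw [← (h1.mul_left m.γ).tsum_eq]
    refine tsum_congr fun t => ?_
    rw [expectAt_startPair_succ, Finset.mul_sum, Finset.mul_sum]
    exact Finset.sum_congr rfl fun s' _ => by ring

/-- The Bellman equation expressing `V` through `Q`. -/
lemma V_eq_sum_Q (m : DMDP S A) {π : S → A → ℝ} (hπ : π ∈ policies S A) (s : S) :
    m.V π s = ∑ a, π s a * m.Q π s a := by
  have h1 : HasSum (fun t => ∑ a, π s a *
      (m.γ ^ t * m.expectAt π (startPair s a) t m.regret)) (∑ a, π s a * m.Q π s a) :=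
    hasSum_sum fun a _ => (m.summable_Q hπ s a).hasSum.mul_left _
  rw [← h1.tsum_eq, V_eq]
  refine tsum_congr fun t => ?_
  have : m.expectAt π (startState π s) t m.regret
      = ∑ a, π s a * m.expectAt π (startPair s a) t m.regret := by
    cases t with
    | zero => rw [expectAt_zero, sum_startState_mul]; simp [actionMean, expectAt_startPair_zero]
    | succ t =>
      rw [expectAt_succ_eq, sum_startState_mul]
      simp only [expectAt_succ_eq, sum_startPair_mul, actionMean]
  rw [this, Finset.mul_sum]
  exact Finset.sum_congr rfl fun a _ => by ring

/-- Summation against the visitation distribution. -/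
lemma hasSum_visitw (m : DMDP S A) {π : S → A → ℝ} (hπ : π ∈ policies S A) (ρ g : S → ℝ) :
    HasSum (fun t => (1 - m.γ) * ∑ s, ρ s * (m.γ ^ t * (m.transitionOp π ^ t) g s))
      (∑ s', m.visitw ρ π s' * g s') := by
  classical
  have hp : ∀ t s s', m.stateProb π t s s' = (m.transitionOp π ^ t) (Pi.single s' 1) s := by
    intro t s s'
    unfold stateProb
    rw [expectAt_startState]
    refine congrArg (fun u => (m.transitionOp π ^ t) u s) (funext fun s₁ => ?_)
    by_cases h : s₁ = s' <;> simp [actionMean, h, (hπ _).2]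
  have h1 : ∀ s s', HasSum (fun t => m.γ ^ t * (m.transitionOp π ^ t) (Pi.single s' 1) s)
      (∑' t, m.γ ^ t * m.stateProb π t s s') := by
    intro s s'
    simp only [hp]
    exact (m.summable_transitionOp hπ _ s).hasSum
  have h2 : HasSum (fun t => ∑ s', (∑ s, ρ s * ((1 - m.γ) *
      (m.γ ^ t * (m.transitionOp π ^ t) (Pi.single s' 1) s))) * g s')
      (∑ s', m.visitw ρ π s' * g s') :=
    hasSum_sum fun s' _ => (hasSum_sum fun s _ =>
      ((h1 s s').mul_left (1 - m.γ)).mul_left (ρ s)).mul_right (g s')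
  refine h2.congr_fun ?_
  intro t
  -- By linearity it suffices to know the powers on indicators of states, which are the state
  -- probabilities.
  have h3 : ∀ s, (m.transitionOp π ^ t) g s
      = ∑ s', g s' * (m.transitionOp π ^ t) (Pi.single s' 1) s := by
    intro s
    conv_lhs => rw [pi_eq_sum_univ' g, map_sum, Finset.sum_apply]
    refine Finset.sum_congr rfl fun s' _ => ?_
    rw [map_smul, Pi.smul_apply, smul_eq_mul]
  simp only [h3, Finset.mul_sum, Finset.sum_mul]
  rw [Finset.sum_comm]
  exact Finset.sum_congr rfl fun s _ => Finset.sum_congr rfl fun s' _ => by ring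

/-- The performance difference lemma. -/
lemma performance_difference (m : DMDP S A) {π π' : S → A → ℝ} (hπ : π ∈ policies S A)
    (hπ' : π' ∈ policies S A) (ρ : S → ℝ) :
    ∑ s, m.visitw ρ π s * ∑ a, m.Q π' s a * (π s a - π' s a)
      = (1 - m.γ) * (m.Vw ρ π - m.Vw ρ π') := by
  -- The value gap solves the Bellman equation of `π` with source the mean advantage over `π'`;
  -- `hasSum_of_bellman` and `hasSum_visitw` then evaluate the same series.
  have hb : ∀ s, (fun s => m.V π s - m.V π' s) s
      = (fun s => ∑ a, m.Q π' s a * (π s a - π' s a)) s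
        + m.γ * m.transitionOp π (fun s => m.V π s - m.V π' s) s := by
    intro s
    have h1 : m.γ * m.transitionOp π (fun s => m.V π s - m.V π' s) s
        = ∑ a, π s a * (m.Q π s a - m.Q π' s a) := by
      rw [transitionOp_apply, Finset.mul_sum]
      refine Finset.sum_congr rfl fun a _ => ?_
      rw [m.Q_eq_R_add hπ, m.Q_eq_R_add hπ']
      simp only [mul_sub, Finset.sum_sub_distrib]
      ring
    rw [h1]
    simp only
    rw [m.V_eq_sum_Q hπ, m.V_eq_sum_Q hπ', ← Finset.sum_add_distrib, ← Finset.sum_sub_distrib]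
    exact Finset.sum_congr rfl fun a _ => by ring
  have h2 := (hasSum_sum fun s (_ : s ∈ Finset.univ) =>
    (m.hasSum_of_bellman hπ hb s).mul_left (ρ s)).mul_left (1 - m.γ)
  rw [(m.hasSum_visitw hπ ρ _).unique h2]
  simp only [Vw, mul_sub, Finset.sum_sub_distrib]

lemma sum_visitw (m : DMDP S A) {π : S → A → ℝ} (hπ : π ∈ policies S A) {ρ : S → ℝ}
    (hρ : ρ ∈ stdSimplex ℝ S) : ∑ s, m.visitw ρ π s = 1 := by
  have h1 := m.hasSum_visitw hπ ρ (fun _ => 1)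
  have h2 := (hasSum_geometric_of_lt_one m.γ_nonneg m.γ_lt_one).mul_left (1 - m.γ)
  have h3 : (fun t => (1 - m.γ) * ∑ s, ρ s * (m.γ ^ t * (m.transitionOp π ^ t) (fun _ => 1) s))
      = fun t => (1 - m.γ) * m.γ ^ t := by
    funext t
    simp only [m.transitionOp_pow_const hπ, ← Finset.sum_mul, hρ.2, one_mul, mul_one]
  rw [h3] at h1
  have h4 := h1.unique h2
  rw [mul_inv_cancel₀ (sub_pos.2 m.γ_lt_one).ne'] at h4
  simpa using h4

/-- The left side is the `t = 0` term of a nonnegative series. Combined with the mismatch bound, it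
dominates `d_ρ(π⋆)` by a multiple of the visitation distribution of any policy. -/
lemma mul_le_visitw (m : DMDP S A) {π : S → A → ℝ} (hπ : π ∈ policies S A) {ρ : S → ℝ}
    (hρ : ρ ∈ stdSimplex ℝ S) (s : S) : (1 - m.γ) * ρ s ≤ m.visitw ρ π s := by
  classical
  have h0 : ∀ s', (0 : ℝ) ≤ (Pi.single s 1 : S → ℝ) s' := fun s' => by
    by_cases h : s' = s <;> simp [h]
  have h1 := m.hasSum_visitw hπ ρ (Pi.single s 1)
  have h2 := h1.summable.le_tsum 0 fun t _ => mul_nonneg (sub_pos.2 m.γ_lt_one).le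
    (Finset.sum_nonneg fun s' _ => mul_nonneg (hρ.1 s') (mul_nonneg (pow_nonneg m.γ_nonneg t)
      (m.transitionOp_pow_nonneg hπ h0 t s')))
  rw [h1.tsum_eq] at h2
  simpa [Pi.single_apply] using h2

lemma visitw_nonneg (m : DMDP S A) {π : S → A → ℝ} (hπ : π ∈ policies S A) {ρ : S → ℝ}
    (hρ : ρ ∈ stdSimplex ℝ S) (s : S) : 0 ≤ m.visitw ρ π s :=
  (mul_nonneg (sub_pos.2 m.γ_lt_one).le (hρ.1 s)).trans (m.mul_le_visitw hπ hρ s)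

lemma Vw_mem (m : DMDP S A) {π : S → A → ℝ} (hπ : π ∈ policies S A) {ρ : S → ℝ}
    (hρ : ρ ∈ stdSimplex ℝ S) : m.Vw ρ π ∈ Icc 0 (1 / (1 - m.γ)) := by
  refine ⟨Finset.sum_nonneg fun s _ => mul_nonneg (hρ.1 s) (m.V_nonneg hπ s), ?_⟩
  calc m.Vw ρ π ≤ ∑ s, ρ s * (1 / (1 - m.γ)) :=
        Finset.sum_le_sum fun s _ => mul_le_mul_of_nonneg_left (m.V_le hπ s) (hρ.1 s)
    _ = _ := by rw [← Finset.sum_mul, hρ.2, one_mul]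

lemma VwOpt_eq (m : DMDP S A) {π : S → A → ℝ} (hπ : m.IsOptimal π) {ρ : S → ℝ}
    (hρ : ρ ∈ stdSimplex ℝ S) : m.VwOpt ρ = m.Vw ρ π := by
  have : IsLeast (m.Vw ρ '' policies S A) (m.Vw ρ π) := by
    refine ⟨mem_image_of_mem _ hπ.1, ?_⟩
    rintro _ ⟨π', hπ', rfl⟩
    exact Finset.sum_le_sum fun s _ => mul_le_mul_of_nonneg_left (hπ.2 π' hπ' s) (hρ.1 s)
  exact this.csInf_eq

/-- The expected discounted regret over the first `H` steps. -/
noncomputable def QTrunc (m : DMDP S A) (H : ℕ) (π : S → A → ℝ) (s : S) (a : A) : ℝ :=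
  ∑ t ∈ Finset.range H, m.γ ^ t * m.expectAt π (startPair s a) t m.regret

/-- The discarded terms are nonnegative and bounded by the geometric tail from `H` on. -/
lemma abs_QTrunc_sub_Q_le (m : DMDP S A) {π : S → A → ℝ} (hπ : π ∈ policies S A) (H : ℕ)
    (s : S) (a : A) : |m.QTrunc H π s a - m.Q π s a| ≤ m.γ ^ H / (1 - m.γ) := by
  have hs := m.summable_Q hπ s a
  have hm := fun t => m.expectAt_startPair_mem hπ s a t (f := m.regret)
      (fun _ => m.R_nonneg _ _) (fun _ => m.R_le_one _ _)
  rw [Q_eq, ← hs.sum_add_tsum_nat_add H, QTrunc, sub_add_cancel_left, abs_neg, abs_of_nonneg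
    (tsum_nonneg fun t => mul_nonneg (pow_nonneg m.γ_nonneg _) (hm _).1), div_eq_mul_inv,
    ← tsum_geometric_of_lt_one m.γ_nonneg m.γ_lt_one, ← tsum_mul_left]
  refine ((summable_nat_add_iff H).2 hs).tsum_le_tsum (fun t => ?_)
    ((summable_geometric_of_lt_one m.γ_nonneg m.γ_lt_one).mul_left _)
  rw [← pow_add, add_comm H t]
  exact mul_le_of_le_one_right (pow_nonneg m.γ_nonneg _) (hm _).2

/-- Consistency of the path laws: the last pair sums out to one. It reconciles sampled trajectories
of length `H` with `expectAt`, which uses length `t + 1`. -/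
lemma sum_pathProb_mul_init (m : DMDP S A) {π : S → A → ℝ} (hπ : π ∈ policies S A)
    (ν : S × A → ℝ) {n : ℕ} (F : (Fin (n + 1) → S × A) → ℝ) :
    ∑ τ : Fin (n + 2) → S × A, m.pathProb π ν τ * F (fun i => τ i.castSucc)
      = ∑ τ, m.pathProb π ν τ * F τ := by
  rw [sum_fin_snoc]
  refine Finset.sum_congr rfl fun τ _ => ?_
  simp only [pathProb_snoc, Fin.snoc_castSucc, Fintype.sum_prod_type]
  simp only [← Finset.sum_mul, mul_assoc, ← Finset.mul_sum]
  congr 1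
  simp [(hπ _).2, ← Finset.sum_mul, m.P_sum]

lemma sum_pathProb_mul_apply (m : DMDP S A) {π : S → A → ℝ} (hπ : π ∈ policies S A)
    (ν : S × A → ℝ) {n : ℕ} (t : Fin (n + 1)) (f : S × A → ℝ) :
    ∑ τ, m.pathProb π ν τ * f (τ t) = m.expectAt π ν t f := by
  induction n with
  | zero =>
    obtain rfl : t = Fin.last 0 := Fin.fin_one_eq_zero t
    rfl
  | succ n ih =>
    refine Fin.lastCases ?_ (fun t => ?_) t
    · rfl
    · rw [m.sum_pathProb_mul_init hπ ν (fun τ => f (τ t)), ih]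
      rfl

lemma expectAt_const (m : DMDP S A) {π : S → A → ℝ} (hπ : π ∈ policies S A) (s : S) (a : A)
    (t : ℕ) (c : ℝ) : m.expectAt π (startPair s a) t (fun _ => c) = c := by
  have : actionMean π (fun _ => c) = fun _ => c := by
    funext s; simp [actionMean, ← Finset.sum_mul, (hπ s).2]
  cases t with
  | zero => rw [expectAt_startPair_zero]
  | succ t =>
    simp only [expectAt_startPair_succ, expectAt_startState, this, m.transitionOp_pow_const hπ,
      ← Finset.sum_mul, m.P_sum, one_mul]

lemma sum_pathProb (m : DMDP S A) {π : S → A → ℝ} (hπ : π ∈ policies S A) (s : S) (a : A)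
    {H : ℕ} (hH : 0 < H) :
    ∑ τ : Fin H → S × A, m.pathProb π (startPair s a) τ = 1 := by
  obtain ⟨n, rfl⟩ := Nat.exists_eq_succ_of_ne_zero hH.ne'
  have := m.sum_pathProb_mul_apply hπ (startPair s a) (0 : Fin (n + 1)) (fun _ => 1)
  rw [m.expectAt_const hπ] at this
  simpa using this

lemma pathProb_nonneg (m : DMDP S A) {π : S → A → ℝ} (hπ : π ∈ policies S A) (s : S) (a : A)
    {H : ℕ} (τ : Fin H → S × A) : 0 ≤ m.pathProb π (startPair s a) τ := by
  classical
  refine Finset.prod_nonneg fun t _ => ?_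
  split_ifs
  · unfold startPair; split_ifs <;> norm_num
  · exact mul_nonneg (m.P_nonneg _ _ _) ((hπ _).1 _)

/-- The discounted regret of a finite trajectory. -/
def pathReturn (m : DMDP S A) {H : ℕ} (τ : Fin H → S × A) : ℝ :=
  ∑ t : Fin H, m.γ ^ (t : ℕ) * m.R (τ t).1 (τ t).2

lemma pathReturn_mem (m : DMDP S A) {H : ℕ} (τ : Fin H → S × A) :
    m.pathReturn τ ∈ Icc 0 (1 / (1 - m.γ)) := by
  refine ⟨Finset.sum_nonneg fun t _ => mul_nonneg (pow_nonneg m.γ_nonneg _) (m.R_nonneg _ _), ?_⟩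
  calc m.pathReturn τ ≤ ∑ t : Fin H, m.γ ^ (t : ℕ) := Finset.sum_le_sum fun t _ =>
        mul_le_of_le_one_right (pow_nonneg m.γ_nonneg _) (m.R_le_one _ _)
    _ = ∑ t ∈ Finset.range H, m.γ ^ t := Fin.sum_univ_eq_sum_range _ _
    _ ≤ ∑' t : ℕ, m.γ ^ t := (summable_geometric_of_lt_one m.γ_nonneg m.γ_lt_one).sum_le_tsum _
        fun t _ => pow_nonneg m.γ_nonneg t
    _ = _ := by rw [tsum_geometric_of_lt_one m.γ_nonneg m.γ_lt_one, one_div]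

lemma sum_pathProb_mul_pathReturn (m : DMDP S A) {π : S → A → ℝ} (hπ : π ∈ policies S A)
    (s : S) (a : A) (H : ℕ) :
    ∑ τ : Fin H → S × A, m.pathProb π (startPair s a) τ * m.pathReturn τ
      = m.QTrunc H π s a := by
  cases H with
  | zero => simp [pathReturn, QTrunc]
  | succ n =>
    simp only [pathReturn, Finset.mul_sum, QTrunc]
    rw [Finset.sum_comm, ← Fin.sum_univ_eq_sum_range
      (fun t => m.γ ^ t * m.expectAt π (startPair s a) t m.regret)]
    refine Finset.sum_congr rfl fun t _ => ?_
    rw [← m.sum_pathProb_mul_apply hπ, Finset.mul_sum]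
    exact Finset.sum_congr rfl fun τ _ => by simp only [regret]; ring

lemma measurable_pathProb {Ω : Type w} [MeasurableSpace Ω] (m : DMDP S A) {π : Ω → S → A → ℝ}
    (hπ : ∀ s a, Measurable fun ω => π ω s a) (s : S) (a : A) {H : ℕ} (τ : Fin H → S × A) :
    Measurable fun ω => m.pathProb (π ω) (startPair s a) τ := by
  refine Finset.measurable_fun_prod _ fun t _ => ?_
  split_ifs
  · exact measurable_const
  · exact (hπ _ _).const_mul _

end Trajectory

end DMDP

/-! ### Bregman divergences and Legendre functions -/

section Bregman

variable {A : Type v} [Fintype A]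

/-- The gradient inequality of a convex function at an interior point of its domain. -/
lemma ConvexOn.fderiv_le_sub {E : Type*} [NormedAddCommGroup E] [NormedSpace ℝ E] {h : E → ℝ}
    {Z : Set E} (hc : ConvexOn ℝ Z h) {p q : E} (hp : p ∈ Z) (hq : q ∈ Z)
    (hd : DifferentiableAt ℝ h q) : fderiv ℝ h q (p - q) ≤ h p - h q := by
  have h1 : HasDerivAt (fun t : ℝ => h (q + t • (p - q))) (fderiv ℝ h q (p - q)) 0 := by
    have h2 : HasDerivAt (fun t : ℝ => q + t • (p - q)) (p - q) 0 := by
      simpa using ((hasDerivAt_id (0 : ℝ)).smul_const (p - q)).const_add q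
    have h3 : HasFDerivAt h (fderiv ℝ h q) (q + (0 : ℝ) • (p - q)) := by
      simpa using hd.hasFDerivAt
    exact h3.comp_hasDerivAt (0 : ℝ) h2
  -- By convexity every slope from `q` towards `p` is at most `h p - h q`, hence so is the limit.
  have h4 := h1.tendsto_slope_zero_right
  refine le_of_tendsto h4 ?_
  filter_upwards [Ioo_mem_nhdsGT (zero_lt_one' ℝ)] with t ht
  have h5 := hc.2 hq hp (sub_nonneg.2 ht.2.le) ht.1.le (by ring)
  have h6 : (1 - t) • q + t • p = q + t • (p - q) := by
    rw [sub_smul, smul_sub, one_smul]; abel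
  rw [h6] at h5
  simp only [zero_add, zero_smul, add_zero, smul_eq_mul] at h5 ⊢
  rw [inv_mul_le_iff₀ ht.1]
  linarith

lemma bregman_nonneg {h : (A → ℝ) → ℝ} {Z : Set (A → ℝ)} (hL : IsLegendre h Z) {p q : A → ℝ}
    (hp : p ∈ Z) (hq : q ∈ interior Z) : 0 ≤ bregman h p q := by
  have := hL.convexOn.fderiv_le_sub hp (interior_subset hq) (hL.differentiableAt q hq)
  unfold bregman
  linarith

lemma bregman_self (h : (A → ℝ) → ℝ) (p : A → ℝ) : bregman h p p = 0 := by
  simp [bregman]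

/-- A minimizer over a convex set meeting the interior of the domain of the sum of a Legendre
function and a linear function lies in the interior of the domain. -/
lemma IsLegendre.mem_interior_of_isMinOn {h : (A → ℝ) → ℝ} {Z : Set (A → ℝ)}
    (hL : IsLegendre h Z) {D : Set (A → ℝ)} (hD : Convex ℝ D) (hDZ : D ⊆ Z)
    (hne : (interior Z ∩ D).Nonempty) (l : (A → ℝ) →L[ℝ] ℝ) {p : A → ℝ} (hp : p ∈ D)
    (hmin : IsMinOn (fun x => h x + l x) D p) : p ∈ interior Z := by
  by_contra hpi
  obtain ⟨x₀, hx₀, hx₀D⟩ := hne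
  have hfr : p ∈ frontier Z := ⟨subset_closure (hDZ hp), hpi⟩
  -- If `p` were on the boundary, steepness would make the gradients blow up along the segment from
  -- `p` to `x₀`; minimality at `p` will bound them instead.
  set y : ℝ → (A → ℝ) := fun t => p + t • (x₀ - p) with hy
  have hyI : ∀ t ∈ Ioo (0 : ℝ) 1, y t ∈ interior Z := fun t ht =>
    hL.convexOn.1.add_smul_sub_mem_interior (hDZ hp) hx₀ ⟨ht.1, ht.2.le⟩
  have hyD : ∀ t ∈ Ioo (0 : ℝ) 1, y t ∈ D := fun t ht =>
    hD.add_smul_sub_mem hp hx₀D ⟨ht.1.le, ht.2.le⟩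
  -- `h` is bounded above near `x₀`
  obtain ⟨r, hr, hball⟩ : ∃ r > 0, ∀ x, ‖x - x₀‖ ≤ r → x ∈ Z ∧ h x ≤ h x₀ + 1 := by
    have h1 : ∀ᶠ x in 𝓝 x₀, x ∈ Z ∧ h x < h x₀ + 1 :=
      Filter.Eventually.and (mem_interior_iff_mem_nhds.1 hx₀)
        ((hL.differentiableAt x₀ hx₀).continuousAt.eventually (gt_mem_nhds (lt_add_one _)))
    obtain ⟨r, hr, h2⟩ := Metric.eventually_nhds_iff.1 h1
    refine ⟨r / 2, by positivity, fun x hx => ?_⟩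
    have := h2 (y := x) (by rw [dist_eq_norm]; linarith)
    exact ⟨this.1, this.2.le⟩
  set B : ℝ := h x₀ + 1 - h p + |l (x₀ - p)| with hB
  have hbound : ∀ t ∈ Ioo (0 : ℝ) 1, ‖fderiv ℝ h (y t)‖ ≤ B / r := by
    intro t ht
    have hd := hL.differentiableAt _ (hyI t ht)
    have hyZ := interior_subset (hyI t ht)
    have hm : h p + l p ≤ h (y t) + l (y t) := hmin (hyD t ht)
    have hl : l (y t) = l p + t * l (x₀ - p) := by simp [hy]
    have hg : fderiv ℝ h (y t) (p - y t) = - (t * fderiv ℝ h (y t) (x₀ - p)) := by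
      have : p - y t = -(t • (x₀ - p)) := by simp [hy]
      rw [this, map_neg, map_smul, smul_eq_mul]
    have h1 := hL.convexOn.fderiv_le_sub (hDZ hp) hyZ hd
    -- Minimality of `p` against `y t` plus the gradient inequality towards `p`, divided by `t`: the
    -- slope along the segment is bounded below uniformly in `t`.
    have h2 : - l (x₀ - p) ≤ fderiv ℝ h (y t) (x₀ - p) := by
      rw [hg] at h1
      have : t * (- l (x₀ - p)) ≤ t * fderiv ℝ h (y t) (x₀ - p) := by linarith
      exact le_of_mul_le_mul_left this ht.1
    -- Gradient inequality from `y t` to `x₀ + v`. The contributions `t * l (x₀ - p)` and `(1 - t) *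
    -- l (x₀ - p)` add up, so `B` does not depend on `t`.
    have hB0 : ∀ v, ‖v‖ ≤ r → fderiv ℝ h (y t) v ≤ B := by
      intro v hv
      obtain ⟨hz, hle⟩ := hball (x₀ + v) (by simpa using hv)
      have h3 := hL.convexOn.fderiv_le_sub hz hyZ hd
      have h4 : x₀ + v - y t = v + (1 - t) • (x₀ - p) := by
        simp only [hy, sub_smul, one_smul]; abel
      rw [h4, map_add, map_smul, smul_eq_mul] at h3
      have h5 : (1 - t) * (- l (x₀ - p)) ≤ (1 - t) * fderiv ℝ h (y t) (x₀ - p) :=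
        mul_le_mul_of_nonneg_left h2 (sub_nonneg.2 ht.2.le)
      have h6 := le_abs_self (l (x₀ - p))
      linarith
    have hBn : 0 ≤ B := by simpa using hB0 0 (by simpa using hr.le)
    refine ContinuousLinearMap.opNorm_le_bound _ (by positivity) fun v => ?_
    rcases eq_or_ne v 0 with rfl | hv
    · simp
    have hv' := norm_pos_iff.2 hv
    have h8 : ∀ σ : ℝ, |σ| = 1 → σ * fderiv ℝ h (y t) v ≤ B / r * ‖v‖ := by
      intro σ hσ
      have h9 := hB0 ((σ * (r / ‖v‖)) • v) (by
        rw [norm_smul, norm_mul, Real.norm_eq_abs, hσ, one_mul, Real.norm_of_nonneg (by positivity),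
          div_mul_cancel₀ _ hv'.ne'])
      rw [map_smul, smul_eq_mul] at h9
      calc σ * fderiv ℝ h (y t) v
          = σ * (r / ‖v‖) * fderiv ℝ h (y t) v * (‖v‖ / r) := by field_simp
        _ ≤ B * (‖v‖ / r) := mul_le_mul_of_nonneg_right h9 (by positivity)
        _ = B / r * ‖v‖ := by ring
    exact abs_le'.2 ⟨by simpa using h8 1 (by simp), by simpa using h8 (-1) (by simp)⟩
  have hty : Tendsto y (𝓝[>] 0) (𝓝[interior Z] p) := by
    refine tendsto_nhdsWithin_iff.2 ⟨?_, ?_⟩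
    · have : Continuous y := by fun_prop
      have h0 : y 0 = p := by simp [hy]
      exact (h0 ▸ this.tendsto 0).mono_left nhdsWithin_le_nhds
    · filter_upwards [Ioo_mem_nhdsGT (zero_lt_one' ℝ)] with t ht using hyI t ht
  have h7 := ((hL.steep p hfr).comp hty).eventually (eventually_gt_atTop (B / r))
  obtain ⟨t, ht1, ht2⟩ := (h7.and (Ioo_mem_nhdsGT (zero_lt_one' ℝ))).exists
  exact absurd (hbound t ht2) (not_le.2 ht1)

/-- The three-point inequality for a mirror descent step. -/
lemma bregman_three_point {h : (A → ℝ) → ℝ} {D : Set (A → ℝ)} (hD : Convex ℝ D)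
    (l : (A → ℝ) →L[ℝ] ℝ) {p q r : A → ℝ} (hp : p ∈ D) (hr : r ∈ D)
    (hd : DifferentiableAt ℝ h p) (hmin : IsMinOn (fun x => l x + bregman h x q) D p) :
    l p + bregman h p q ≤ l r + bregman h r q - bregman h r p := by
  have h1 : HasFDerivAt (fun x => l x + bregman h x q) (l + (fderiv ℝ h p - fderiv ℝ h q)) p := by
    unfold bregman
    have h2 : HasFDerivAt (fun x => fderiv ℝ h q (x - q)) (fderiv ℝ h q) p := by
      exact (fderiv ℝ h q).hasFDerivAt.comp p ((hasFDerivAt_id p).sub_const q)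
    exact l.hasFDerivAt.add ((hd.hasFDerivAt.sub_const _).sub h2)
  -- First-order optimality of `p` in the feasible direction `r - p`; the rest is an identity
  -- between Bregman terms.
  have h3 : 0 ≤ (l + (fderiv ℝ h p - fderiv ℝ h q)) (r - p) :=
    (hmin.localize).hasFDerivWithinAt_nonneg h1.hasFDerivWithinAt
      (sub_mem_posTangentConeAt_of_segment_subset (hD.segment_subset hp hr))
  simp only [add_apply, sub_apply, map_sub] at h3
  simp only [bregman, map_sub]
  linarith

/-- Points of the simplex with positive coordinates lie in the interior of every convex set
that contains the simplex and whose interior meets it. -/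
lemma mem_interior_of_pos {Z : Set (A → ℝ)} (hZ : Convex ℝ Z) (hs : stdSimplex ℝ A ⊆ Z)
    (hne : (interior Z ∩ stdSimplex ℝ A).Nonempty) {p : A → ℝ} (hp : p ∈ stdSimplex ℝ A)
    (hpos : ∀ a, 0 < p a) : p ∈ interior Z := by
  obtain ⟨x, hx, hxs⟩ := hne
  have hev : ∀ᶠ t : ℝ in 𝓝[>] 0, ∀ a, 0 ≤ p a - t * x a := by
    refine eventually_all.2 fun a => ?_
    have : Tendsto (fun t : ℝ => p a - t * x a) (𝓝 0) (𝓝 (p a - 0 * x a)) :=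
      (by fun_prop : Continuous fun t : ℝ => p a - t * x a).tendsto 0
    rw [zero_mul, sub_zero] at this
    filter_upwards [(this.mono_left nhdsWithin_le_nhds).eventually (lt_mem_nhds (hpos a))]
      with t ht using ht.le
  obtain ⟨t, ht, ht01⟩ := (hev.and (Ioo_mem_nhdsGT (zero_lt_one' ℝ))).exists
  have h1t : 0 < 1 - t := sub_pos.2 ht01.2
  -- For small `t`, `p` is a proper convex combination of the interior point `x` and this point `q`
  -- of the simplex.
  have hq : (1 - t)⁻¹ • (p - t • x) ∈ stdSimplex ℝ A := by
    refine ⟨fun a => mul_nonneg (inv_nonneg.2 h1t.le) (by simpa using ht a), ?_⟩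
    simp only [Pi.smul_apply, Pi.sub_apply, smul_eq_mul, ← Finset.mul_sum,
      Finset.sum_sub_distrib, hp.2, hxs.2]
    field_simp
  have := hZ.combo_interior_self_mem_interior hx (hs hq) ht01.1 h1t.le (by ring)
  rwa [smul_inv_smul₀ h1t.ne', add_sub_cancel] at this

end Bregman

/-! ### Hoeffding's inequality for conditionally independent samples -/

section Concentration

/-- Hoeffding's lemma for a probability vector. -/
lemma sum_mul_exp_le {X : Type*} [Fintype X] {p f : X → ℝ} (hp : p ∈ stdSimplex ℝ X) {a b : ℝ}
    (hf : ∀ x, f x ∈ Icc a b) (c : ℝ) :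
    ∑ x, p x * Real.exp (c * (f x - ∑ y, p y * f y)) ≤ Real.exp (c ^ 2 * (b - a) ^ 2 / 8) := by
  let _ : MeasurableSpace X := ⊤
  let P : PMF X := PMF.ofFintype (fun x => ENNReal.ofReal (p x)) (by
    rw [← ENNReal.ofReal_sum_of_nonneg fun x _ => hp.1 x, hp.2, ENNReal.ofReal_one])
  have hP : ∀ x, (P x).toReal = p x := fun x => by
    simp [P, ENNReal.toReal_ofReal (hp.1 x)]
  have h := (hasSubgaussianMGF_of_mem_Icc (μ := P.toMeasure) (X := f) (a := a) (b := b)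
    (by fun_prop) (ae_of_all _ hf)).mgf_le c
  simp only [mgf, PMF.integral_eq_sum, hP, smul_eq_mul] at h
  refine h.trans (le_of_eq ?_)
  congr 1
  simp only [NNReal.coe_pow, NNReal.coe_div, coe_nnnorm, Real.norm_eq_abs, div_pow, sq_abs]
  norm_num
  ring

/-- Independence factorizes the moment generating function: the sum over tuples is the `M`-th power
of the sum for one sample. -/
lemma sum_prod_mul_exp_le {X : Type*} [Fintype X] {p f : X → ℝ} (hp : p ∈ stdSimplex ℝ X)
    {a b : ℝ} (hf : ∀ x, f x ∈ Icc a b) (M : ℕ) (c : ℝ) :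
    ∑ τ : Fin M → X, (∏ i, p (τ i)) * Real.exp (c * ∑ i, (f (τ i) - ∑ y, p y * f y))
      ≤ Real.exp (M * (c ^ 2 * (b - a) ^ 2 / 8)) := by
  classical
  have h1 : ∑ τ : Fin M → X, (∏ i, p (τ i)) * Real.exp (c * ∑ i, (f (τ i) - ∑ y, p y * f y))
      = (∑ x, p x * Real.exp (c * (f x - ∑ y, p y * f y))) ^ M := by
    rw [Finset.sum_pow', Fintype.piFinset_univ]
    refine Finset.sum_congr rfl fun τ _ => ?_
    rw [Finset.mul_sum, Real.exp_sum, Finset.prod_mul_distrib]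
  rw [h1, Real.exp_nat_mul]
  exact pow_le_pow_left₀ (Finset.sum_nonneg fun x _ => mul_nonneg (hp.1 x) (Real.exp_pos _).le)
    (sum_mul_exp_le hp hf c) M

open Classical in
/-- Hoeffding's inequality for independent samples from a probability vector. -/
lemma sum_prod_deviation_le {X : Type*} [Fintype X] {p f : X → ℝ} (hp : p ∈ stdSimplex ℝ X)
    {b t : ℝ} (hb : 0 < b) (ht : 0 ≤ t) (hf : ∀ x, f x ∈ Icc 0 b) {M : ℕ} (hM : 0 < M) :
    ∑ τ : Fin M → X, (if t < |1 / (M : ℝ) * ∑ i, f (τ i) - ∑ y, p y * f y| then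
        ∏ i, p (τ i) else 0) ≤ 2 * Real.exp (-(2 * M * t ^ 2 / b ^ 2)) := by
  have hM' : (0 : ℝ) < M := Nat.cast_pos.2 hM
  -- This `c` minimizes the Chernoff exponent `-c M t + M c² b² / 8`.
  set c : ℝ := 4 * t / b ^ 2 with hc
  have hc0 : 0 ≤ c := by positivity
  set e : (Fin M → X) → ℝ := fun τ => ∑ i, (f (τ i) - ∑ y, p y * f y) with he
  -- Markov's inequality termwise; the sum of the two exponentials covers both signs of the
  -- deviation.
  have hterm : ∀ τ : Fin M → X,
      (if t < |1 / (M : ℝ) * ∑ i, f (τ i) - ∑ y, p y * f y| then ∏ i, p (τ i) else 0)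
        ≤ Real.exp (-(c * (M * t))) * ((∏ i, p (τ i)) * Real.exp (c * e τ)
          + (∏ i, p (τ i)) * Real.exp (-c * e τ)) := by
    intro τ
    have hpr : 0 ≤ ∏ i, p (τ i) := Finset.prod_nonneg fun i _ => hp.1 _
    split_ifs with h
    · have h1 : M * t ≤ |e τ| := by
        have : e τ = M * (1 / (M : ℝ) * ∑ i, f (τ i) - ∑ y, p y * f y) := by
          simp only [he, Finset.sum_sub_distrib, Finset.sum_const, Finset.card_univ,
            Fintype.card_fin, nsmul_eq_mul]
          field_simp
        rw [this, abs_mul, abs_of_pos hM']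
        exact mul_le_mul_of_nonneg_left h.le hM'.le
      have h2 : Real.exp (c * (M * t)) ≤ Real.exp (c * e τ) + Real.exp (-c * e τ) := by
        have h3 := mul_le_mul_of_nonneg_left h1 hc0
        rcases abs_cases (e τ) with ⟨h4, -⟩ | ⟨h4, -⟩
        · rw [h4] at h3
          linarith [Real.exp_le_exp.2 h3, Real.exp_pos (-c * e τ)]
        · rw [h4, ← neg_mul_comm] at h3
          linarith [Real.exp_le_exp.2 h3, Real.exp_pos (c * e τ)]
      rw [← mul_add, mul_left_comm]
      refine le_mul_of_one_le_right hpr ?_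
      calc (1 : ℝ) = Real.exp (-(c * (M * t))) * Real.exp (c * (M * t)) := by
            rw [← Real.exp_add]; simp
        _ ≤ _ := mul_le_mul_of_nonneg_left h2 (Real.exp_pos _).le
    · positivity
  have hs := sum_prod_mul_exp_le hp hf M c
  have hs' := sum_prod_mul_exp_le hp hf M (-c)
  calc _ ≤ ∑ τ : Fin M → X, Real.exp (-(c * (M * t))) * ((∏ i, p (τ i)) * Real.exp (c * e τ)
          + (∏ i, p (τ i)) * Real.exp (-c * e τ)) := Finset.sum_le_sum fun τ _ => hterm τ
    _ ≤ Real.exp (-(c * (M * t))) * (Real.exp (M * (c ^ 2 * (b - 0) ^ 2 / 8))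
          + Real.exp (M * ((-c) ^ 2 * (b - 0) ^ 2 / 8))) := by
        rw [← Finset.mul_sum, Finset.sum_add_distrib]
        exact mul_le_mul_of_nonneg_left (add_le_add hs hs') (Real.exp_pos _).le
    _ = 2 * Real.exp (-(2 * M * t ^ 2 / b ^ 2)) := by
        rw [neg_sq, ← two_mul, mul_left_comm, ← Real.exp_add]
        congr 2
        rw [hc]
        field_simp
        ring

lemma measurableSet_deviation {Ω : Type w} [MeasurableSpace Ω] {X : Type*} [Fintype X]
    {p : Ω → X → ℝ} (hp : ∀ x, Measurable fun ω => p ω x) (f : X → ℝ) (c t : ℝ) :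
    MeasurableSet {ω | t < |c - ∑ y, p ω y * f y|} :=
  measurableSet_lt measurable_const
    (((Finset.measurable_fun_sum _ fun y _ => (hp y).mul_const (f y)).const_sub c).abs)

/-- Hoeffding's inequality for samples that are, given a sub-σ-algebra, independent with a
common finitely supported law. -/
lemma measureReal_deviation_le {Ω : Type w} {m mΩ : MeasurableSpace Ω} (hm : m ≤ mΩ)
    (μ : Measure Ω) [IsProbabilityMeasure μ] {X : Type*} [Fintype X] {M : ℕ} (hM : 0 < M)
    {T : Fin M → Ω → X} (hT : ∀ i x, MeasurableSet {ω | T i ω = x}) {p : Ω → X → ℝ}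
    (hpm : ∀ x, Measurable[m] fun ω => p ω x) (hp : ∀ ω, p ω ∈ stdSimplex ℝ X)
    (hlaw : ∀ τ : Fin M → X, μ[({ω | ∀ i, T i ω = τ i}).indicator (fun _ => (1 : ℝ)) | m]
      =ᵐ[μ] fun ω => ∏ i, p ω (τ i))
    {f : X → ℝ} {b t : ℝ} (hb : 0 < b) (ht : 0 ≤ t) (hf : ∀ x, f x ∈ Icc 0 b) :
    μ.real {ω | t < |1 / (M : ℝ) * ∑ i, f (T i ω) - ∑ y, p ω y * f y|}
      ≤ 2 * Real.exp (-(2 * M * t ^ 2 / b ^ 2)) := by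
  classical
  -- Freezing the sample at `τ` leaves an event of the smaller σ-algebra, over which the conditional
  -- law can be integrated.
  set B : (Fin M → X) → Set Ω := fun τ =>
    {ω | t < |1 / (M : ℝ) * ∑ i, f (τ i) - ∑ y, p ω y * f y|} with hB
  have hBm : ∀ τ, MeasurableSet[m] (B τ) := fun τ => @measurableSet_deviation Ω m X _ p hpm f _ t
  have hE : ∀ τ : Fin M → X, MeasurableSet {ω | ∀ i, T i ω = τ i} := fun τ => by
    rw [ofPred_forall]
    exact MeasurableSet.iInter fun i => hT i (τ i)
  have hpi : ∀ τ : Fin M → X, Integrable (fun ω => ∏ i, p ω (τ i)) μ := fun τ =>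
    integrable_condExp.congr (hlaw τ)
  have hterm : ∀ τ, μ.real ({ω | ∀ i, T i ω = τ i} ∩ B τ)
      = ∫ ω, (B τ).indicator (fun ω => ∏ i, p ω (τ i)) ω ∂μ := by
    intro τ
    rw [integral_indicator (hm _ (hBm τ)), ← setIntegral_congr_ae (hm _ (hBm τ))
      ((hlaw τ).mono fun ω h _ => h), setIntegral_condExp hm
      ((integrable_const 1).indicator (hE τ)) (hBm τ), setIntegral_indicator (hE τ), inter_comm]
    simp
  have hsub : {ω | t < |1 / (M : ℝ) * ∑ i, f (T i ω) - ∑ y, p ω y * f y|}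
      ⊆ ⋃ τ, {ω | ∀ i, T i ω = τ i} ∩ B τ := fun ω hω =>
    mem_iUnion.2 ⟨fun i => T i ω, fun i => rfl, hω⟩
  calc _ ≤ ∑ τ, μ.real ({ω | ∀ i, T i ω = τ i} ∩ B τ) :=
        (measureReal_mono hsub).trans (measureReal_iUnion_fintype_le _)
    _ = ∫ ω, ∑ τ, (B τ).indicator (fun ω => ∏ i, p ω (τ i)) ω ∂μ := by
        rw [integral_finsetSum _ fun τ _ => (hpi τ).indicator (hm _ (hBm τ))]
        exact Finset.sum_congr rfl fun τ _ => hterm τ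
    _ ≤ ∫ _, 2 * Real.exp (-(2 * M * t ^ 2 / b ^ 2)) ∂μ := by
        refine integral_mono (integrable_finsetSum _ fun τ _ =>
          (hpi τ).indicator (hm _ (hBm τ))) (integrable_const _) fun ω => ?_
        simp only [indicator_apply]
        exact sum_prod_deviation_le (hp ω) hb ht hf hM
    _ = _ := by simp

end Concentration

namespace DMDP

/-! ### Convergence of inexact policy mirror descent -/

section MirrorDescent

variable {S : Type u} {A : Type v} [Fintype S] [Fintype A]

/-- Two points of the simplex are at `ℓ¹` distance at most `2`; this is the price of replacing `Q`
by its estimate. -/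
lemma abs_sum_mul_sub_le {c : A → ℝ} {τ : ℝ} (hc : ∀ a, |c a| ≤ τ)
    {p q : A → ℝ} (hp : p ∈ stdSimplex ℝ A) (hq : q ∈ stdSimplex ℝ A) :
    |∑ a, c a * (p a - q a)| ≤ 2 * τ := by
  calc |∑ a, c a * (p a - q a)| ≤ ∑ a, τ * (p a + q a) :=
        (Finset.abs_sum_le_sum_abs _ _).trans <| Finset.sum_le_sum fun a _ => by
          rw [abs_mul]
          have h1 : |p a - q a| ≤ p a + q a :=
            abs_sub_le_iff.2 ⟨by linarith [hq.1 a], by linarith [hp.1 a]⟩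
          exact mul_le_mul (hc a) h1 (abs_nonneg _) ((abs_nonneg _).trans (hc a))
    _ = 2 * τ := by rw [← Finset.mul_sum, Finset.sum_add_distrib, hp.2, hq.2]; ring

/-- The linear form `p ↦ c ∑ₐ qₐ pₐ`. -/
noncomputable def linearCost (c : ℝ) (q : A → ℝ) : (A → ℝ) →L[ℝ] ℝ :=
  c • ∑ a, q a • ContinuousLinearMap.proj (R := ℝ) (φ := fun _ : A => ℝ) a

lemma linearCost_apply (c : ℝ) (q p : A → ℝ) : linearCost c q p = c * ∑ a, q a * p a := by
  simp [linearCost]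

/-- A mirror descent step stays in the interior of the domain of the mirror map. -/
lemma mem_interior_of_step {h : (A → ℝ) → ℝ} {Z : Set (A → ℝ)} (hL : IsLegendre h Z)
    (hsZ : stdSimplex ℝ A ⊆ Z) (hne : (interior Z ∩ stdSimplex ℝ A).Nonempty) {c : ℝ}
    {q x y : A → ℝ} (hy : y ∈ stdSimplex ℝ A)
    (hmin : IsMinOn (fun p : A → ℝ => c * ∑ a, q a * p a + bregman h p x) (stdSimplex ℝ A) y) :
    y ∈ interior Z := by
  -- Up to a constant, the Bregman divergence in its first argument is `h` plus a linear form.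
  refine hL.mem_interior_of_isMinOn (convex_stdSimplex ℝ A) hsZ hne
    (linearCost c q - fderiv ℝ h x) hy fun p hp => ?_
  have := hmin hp
  simp only [bregman, map_sub, mem_ofPred_eq, sub_apply, linearCost_apply] at this ⊢
  linarith

/-- One step of inexact policy mirror descent with a linearized objective. -/
lemma step_three_point {h : (A → ℝ) → ℝ} {Z : Set (A → ℝ)} (hL : IsLegendre h Z)
    {c : ℝ} {q x y : A → ℝ} (hy : y ∈ stdSimplex ℝ A) (hyZ : y ∈ interior Z)
    (hmin : IsMinOn (fun p : A → ℝ => c * ∑ a, q a * p a + bregman h p x) (stdSimplex ℝ A) y)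
    {p : A → ℝ} (hp : p ∈ stdSimplex ℝ A) :
    c * ∑ a, q a * (y a - p a) + bregman h y x ≤ bregman h p x - bregman h p y := by
  have h1 := bregman_three_point (convex_stdSimplex ℝ A) (linearCost c q) hy hp
    (hL.differentiableAt y hyZ) (by simpa only [linearCost_apply] using hmin)
  simp only [linearCost_apply] at h1
  simp only [mul_sub, Finset.sum_sub_distrib]
  linarith

/-- One iteration of inexact policy mirror descent. -/
lemma inexact_step (m : DMDP S A) {ρ : S → ℝ} (hρ : ρ ∈ stdSimplex ℝ S) {πs : S → A → ℝ}
    (hπs : πs ∈ policies S A) {θ : ℝ} (hθ : 0 ≤ θ)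
    (hmis : ∀ s, m.visitw ρ πs s ≤ θ * ((1 - m.γ) * ρ s)) {h : (A → ℝ) → ℝ} {Z : Set (A → ℝ)}
    (hL : IsLegendre h Z) (hsZ : stdSimplex ℝ A ⊆ Z) {η τ : ℝ} (hη : 0 < η)
    {x y q : S → A → ℝ} (hx : x ∈ policies S A) (hxZ : ∀ s, x s ∈ interior Z)
    (hy : y ∈ policies S A) (hyZ : ∀ s, y s ∈ interior Z)
    (hq : ∀ s a, |q s a - m.Q x s a| ≤ τ)
    (hmin : ∀ s, IsMinOn (fun p : A → ℝ => η * ∑ a, q s a * p a + bregman h p (x s))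
      (stdSimplex ℝ A) (y s)) :
    η * ((1 - m.γ) * (θ * (m.Vw ρ y - m.Vw ρ x) + (m.Vw ρ x - m.Vw ρ πs)) - 2 * τ * (1 + θ))
      ≤ bregmanw h (m.visitw ρ πs) πs x - bregmanw h (m.visitw ρ πs) πs y := by
  have hd0 := m.visitw_nonneg hπs hρ
  set G : S → ℝ := fun s => ∑ a, q s a * (y s a - x s a) with hG
  -- the estimated improvement is nonpositive in every state
  have hG0 : ∀ s, G s ≤ 0 := by
    intro s
    have h1 := step_three_point hL (hy s) (hyZ s) (hmin s) (hx s)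
    rw [bregman_self] at h1
    have h2 := bregman_nonneg hL (hsZ (hy s)) (hxZ s)
    have h3 := bregman_nonneg hL (hsZ (hx s)) (hyZ s)
    have h4 : η * G s ≤ η * 0 := by linarith
    exact le_of_mul_le_mul_left h4 hη
  have hsplit : ∀ (p r : S → A → ℝ), p ∈ policies S A → r ∈ policies S A → ∀ s,
      ∑ a, m.Q x s a * (p s a - r s a) - 2 * τ ≤ ∑ a, q s a * (p s a - r s a) := by
    intro p r hp hr s
    have h1 := (abs_le.1 (abs_sum_mul_sub_le (hq s) (hp s) (hr s))).1
    simp only [sub_mul, Finset.sum_sub_distrib] at h1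
    linarith
  -- change of measure
  have h1 : θ * ((1 - m.γ) * (m.Vw ρ y - m.Vw ρ x) - 2 * τ) ≤ ∑ s, m.visitw ρ πs s * G s := by
    rw [← m.performance_difference hy hx ρ]
    calc θ * (∑ s, m.visitw ρ y s * ∑ a, m.Q x s a * (y s a - x s a) - 2 * τ)
        = θ * ∑ s, m.visitw ρ y s * (∑ a, m.Q x s a * (y s a - x s a) - 2 * τ) := by
          simp only [mul_sub, Finset.sum_sub_distrib, ← Finset.sum_mul, m.sum_visitw hy hρ]
          ring
      _ ≤ θ * ∑ s, m.visitw ρ y s * G s := mul_le_mul_of_nonneg_left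
          (Finset.sum_le_sum fun s _ => mul_le_mul_of_nonneg_left (hsplit y x hy hx s)
            (m.visitw_nonneg hy hρ s)) hθ
      _ = ∑ s, θ * m.visitw ρ y s * G s := by
          rw [Finset.mul_sum]; exact Finset.sum_congr rfl fun s _ => by ring
      -- Here `d_ρ(π⋆) ≤ θ (1-γ) ρ ≤ θ d_ρ(y)`, and the sign of `G` reverses the inequality.
      _ ≤ ∑ s, m.visitw ρ πs s * G s := Finset.sum_le_sum fun s _ =>
          mul_le_mul_of_nonpos_right ((hmis s).trans
            (mul_le_mul_of_nonneg_left (m.mul_le_visitw hy hρ s) hθ)) (hG0 s)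
  have h2 : (1 - m.γ) * (m.Vw ρ x - m.Vw ρ πs) - 2 * τ
      ≤ ∑ s, m.visitw ρ πs s * ∑ a, q s a * (x s a - πs s a) := by
    have h3 : (1 - m.γ) * (m.Vw ρ x - m.Vw ρ πs)
        = ∑ s, m.visitw ρ πs s * ∑ a, m.Q x s a * (x s a - πs s a) := by
      rw [← neg_sub (m.Vw ρ πs), mul_neg, ← m.performance_difference hπs hx ρ, ← Finset.sum_neg_distrib]
      refine Finset.sum_congr rfl fun s _ => ?_
      rw [← mul_neg, ← Finset.sum_neg_distrib]
      exact congrArg _ (Finset.sum_congr rfl fun a _ => by ring)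
    calc _ = ∑ s, m.visitw ρ πs s * (∑ a, m.Q x s a * (x s a - πs s a) - 2 * τ) := by
          rw [h3]
          simp only [mul_sub, Finset.sum_sub_distrib, ← Finset.sum_mul, m.sum_visitw hπs hρ]
          ring
      _ ≤ _ := Finset.sum_le_sum fun s _ =>
          mul_le_mul_of_nonneg_left (hsplit x πs hx hπs s) (hd0 s)
  -- The step is tested against `π⋆`, with `y - π⋆` split as `(y - x) + (x - π⋆)`.
  have h4 : η * (∑ s, m.visitw ρ πs s * G s
      + ∑ s, m.visitw ρ πs s * ∑ a, q s a * (x s a - πs s a))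
      ≤ bregmanw h (m.visitw ρ πs) πs x - bregmanw h (m.visitw ρ πs) πs y := by
    unfold bregmanw
    rw [← Finset.sum_add_distrib, ← Finset.sum_sub_distrib, Finset.mul_sum]
    refine Finset.sum_le_sum fun s _ => ?_
    have h5 := step_three_point hL (hy s) (hyZ s) (hmin s) (hπs s)
    have h6 := bregman_nonneg hL (hsZ (hy s)) (hxZ s)
    have h7 : G s + ∑ a, q s a * (x s a - πs s a) = ∑ a, q s a * (y s a - πs s a) := by
      rw [hG, ← Finset.sum_add_distrib]
      exact Finset.sum_congr rfl fun a _ => by ring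
    rw [← mul_add, h7, mul_left_comm, ← mul_sub]
    exact mul_le_mul_of_nonneg_left (by linarith) (hd0 s)
  refine le_trans (mul_le_mul_of_nonneg_left ?_ hη.le) h4
  linarith

/-- Linear convergence of inexact policy mirror descent up to an error proportional to the
accuracy of the estimates of the `Q`-functions. -/
theorem inexact_pmd_bound (m : DMDP S A) (hγ : 0 < m.γ) {ρ : S → ℝ} (hρ : ρ ∈ stdSimplex ℝ S)
    {πs : S → A → ℝ} (hπs : πs ∈ policies S A) {θ : ℝ} (hθ : 1 / (1 - m.γ) ≤ θ)
    (hmis : ∀ s, m.visitw ρ πs s ≤ θ * ((1 - m.γ) * ρ s)) {h : (A → ℝ) → ℝ} {Z : Set (A → ℝ)}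
    (hL : IsLegendre h Z) (hsZ : stdSimplex ℝ A ⊆ Z)
    (hne : (interior Z ∩ stdSimplex ℝ A).Nonempty) {η : ℕ → ℝ} (hη0 : 0 < η 0)
    {x q : ℕ → S → A → ℝ} (hx0 : x 0 ∈ policiesInterior S A)
    (hη : (1 - m.γ) / m.γ * bregmanw h (m.visitw ρ πs) πs (x 0) ≤ η 0)
    (hηs : ∀ k, 1 / m.γ * η k ≤ η (k + 1)) {K : ℕ} {τ : ℝ} (hτ : 0 ≤ τ)
    (hq : ∀ k < K, ∀ s a, |q k s a - m.Q (x k) s a| ≤ τ)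
    (hmem : ∀ k < K, ∀ s, x (k + 1) s ∈ stdSimplex ℝ A)
    (hmin : ∀ k < K, ∀ s, IsMinOn (fun p : A → ℝ =>
      η k * ∑ a, q k s a * p a + bregman h p (x k s)) (stdSimplex ℝ A) (x (k + 1) s)) :
    m.Vw ρ (x K) - m.Vw ρ πs
      ≤ (1 - 1 / θ) ^ K * (2 / (1 - m.γ)) + 4 * θ * τ / (1 - m.γ) := by
  have hg : 0 < 1 - m.γ := sub_pos.2 m.γ_lt_one
  have hθg : 1 ≤ θ * (1 - m.γ) := by rwa [div_le_iff₀ hg] at hθ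
  have hθ1 : 1 < θ := by
    refine lt_of_lt_of_le ?_ hθ
    rw [lt_div_iff₀ hg]; linarith
  have hθ0 : 0 < θ := one_pos.trans hθ1
  have hr : 0 ≤ 1 - 1 / θ := by
    rw [sub_nonneg, div_le_one hθ0]; exact hθ1.le
  have hηp : ∀ k, 0 < η k := by
    intro k
    induction k with
    | zero => exact hη0
    | succ k ih => exact lt_of_lt_of_le (by positivity) (hηs k)
  have hxp : ∀ k ≤ K, x k ∈ policies S A := by
    intro k hk
    cases k with
    | zero => exact hx0.1
    | succ k => exact hmem k hk
  have hxZ : ∀ k ≤ K, ∀ s, x k s ∈ interior Z := by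
    intro k hk s
    cases k with
    | zero => exact mem_interior_of_pos hL.convexOn.1 hsZ hne (hx0.1 s) (hx0.2 s)
    | succ k => exact mem_interior_of_step hL hsZ hne (hmem k hk s) (hmin k hk s)
  set D : ℕ → ℝ := fun k => bregmanw h (m.visitw ρ πs) πs (x k) with hD
  have hD0 : ∀ k ≤ K, 0 ≤ D k := fun k hk => Finset.sum_nonneg fun s _ =>
    mul_nonneg (m.visitw_nonneg hπs hρ s) (bregman_nonneg hL (hsZ (hπs s)) (hxZ k hk s))
  set E : ℝ := 4 * θ * τ / (1 - m.γ) with hE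
  -- Dividing by `θ - 1` rather than `θ` makes the distance term carry the same factor `1 - 1/θ` as
  -- the value gap (`h5` below).
  set Φ : ℕ → ℝ := fun k => m.Vw ρ (x k) - m.Vw ρ πs
    + D k / ((1 - m.γ) * (η k * (θ - 1))) with hΦ
  have hden : ∀ k, 0 < (1 - m.γ) * (η k * (θ - 1)) := fun k =>
    mul_pos hg (mul_pos (hηp k) (sub_pos.2 hθ1))
  have hrec : ∀ k < K, Φ (k + 1) - E ≤ (1 - 1 / θ) * (Φ k - E) := by
    intro k hk
    have h1 := m.inexact_step hρ hπs hθ0.le hmis hL hsZ (hηp k) (hxp k hk.le) (hxZ k hk.le)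
      (hxp (k + 1) hk) (hxZ (k + 1) hk) (hq k hk) (hmin k hk)
    -- The step-size growth `1/γ` compensates for the loss from `θ` to `θ - 1 ≥ γ θ`.
    have h2 : η k * θ ≤ η (k + 1) * (θ - 1) := by
      have h3 : m.γ * θ ≤ θ - 1 := by linarith
      calc η k * θ = 1 / m.γ * η k * (m.γ * θ) := by field_simp
        _ ≤ η (k + 1) * (θ - 1) :=
          mul_le_mul (hηs k) h3 (by positivity) (hηp (k + 1)).le
    have h4 : D (k + 1) / ((1 - m.γ) * (η (k + 1) * (θ - 1)))
        ≤ D (k + 1) / ((1 - m.γ) * (η k * θ)) :=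
      div_le_div_of_nonneg_left (hD0 (k + 1) hk) (mul_pos hg (mul_pos (hηp k) hθ0))
        (mul_le_mul_of_nonneg_left h2 hg.le)
    have h5 : D k / ((1 - m.γ) * (η k * θ))
        = (1 - 1 / θ) * (D k / ((1 - m.γ) * (η k * (θ - 1)))) := by
      have := (hηp k).ne'
      have := (sub_pos.2 hθ1).ne'
      field_simp
    have h6 : (m.Vw ρ (x (k + 1)) - m.Vw ρ πs)
        + D (k + 1) / ((1 - m.γ) * (η k * θ))
        ≤ (1 - 1 / θ) * (m.Vw ρ (x k) - m.Vw ρ πs) + D k / ((1 - m.γ) * (η k * θ))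
          + 2 * τ * (1 + θ) / ((1 - m.γ) * θ) := by
      have h7 := div_le_div_of_nonneg_right h1 (mul_pos hg (mul_pos (hηp k) hθ0)).le
      have h8 : η k * ((1 - m.γ) * (θ * (m.Vw ρ (x (k + 1)) - m.Vw ρ (x k))
          + (m.Vw ρ (x k) - m.Vw ρ πs)) - 2 * τ * (1 + θ)) / ((1 - m.γ) * (η k * θ))
          = (m.Vw ρ (x (k + 1)) - m.Vw ρ πs) - (1 - 1 / θ) * (m.Vw ρ (x k) - m.Vw ρ πs)
            - 2 * τ * (1 + θ) / ((1 - m.γ) * θ) := by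
        have := (hηp k).ne'
        field_simp
        ring
      rw [h8, sub_div] at h7
      linarith
    -- Since `1 + θ ≤ 2θ`, the noise per step is at most `E / θ`, which is what the contraction
    -- towards `E` absorbs.
    have h9 : 2 * τ * (1 + θ) / ((1 - m.γ) * θ) ≤ E / θ := by
      rw [hE, div_div, div_le_div_iff_of_pos_right (mul_pos hg hθ0)]
      nlinarith
    have h10 : (1 - 1 / θ) * (Φ k - E) = (1 - 1 / θ) * (m.Vw ρ (x k) - m.Vw ρ πs)
        + (1 - 1 / θ) * (D k / ((1 - m.γ) * (η k * (θ - 1)))) - E + E / θ := by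
      simp only [hΦ]; ring
    rw [h10, ← h5]
    simp only [hΦ]
    linarith
  have h0 : Φ 0 - E ≤ 2 / (1 - m.γ) := by
    have h1 := (m.Vw_mem (hxp 0 (Nat.zero_le _)) hρ).2
    have h2 := (m.Vw_mem hπs hρ).1
    -- The lower bound on `η 0` and `θ - 1 ≥ γ/(1-γ)` make the initial distance term no larger than
    -- the bound on the value gap.
    have h3 : D 0 / ((1 - m.γ) * (η 0 * (θ - 1))) ≤ 1 / (1 - m.γ) := by
      rw [div_le_div_iff₀ (hden 0) hg, one_mul, mul_comm]
      refine mul_le_mul_of_nonneg_left ?_ hg.le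
      have h4 : m.γ / (1 - m.γ) ≤ θ - 1 := by
        rw [div_le_iff₀ hg]; linarith
      calc D 0 = (1 - m.γ) / m.γ * D 0 * (m.γ / (1 - m.γ)) := by field_simp
        _ ≤ η 0 * (θ - 1) := mul_le_mul hη h4 (by positivity) hη0.le
    have h5 : 0 ≤ E := by positivity
    have h6 : 2 / (1 - m.γ) = 1 / (1 - m.γ) + 1 / (1 - m.γ) := by ring
    simp only [hΦ]
    linarith
  have hind : ∀ k ≤ K, Φ k - E ≤ (1 - 1 / θ) ^ k * (2 / (1 - m.γ)) := by
    intro k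
    induction k with
    | zero => intro _; simpa using h0
    | succ k ih =>
      intro hk
      rw [pow_succ', mul_assoc]
      exact (hrec k hk).trans (mul_le_mul_of_nonneg_left (ih (Nat.le_of_succ_le hk)) hr)
  have h1 := hind K le_rfl
  have h2 : 0 ≤ D K / ((1 - m.γ) * (η K * (θ - 1))) := div_nonneg (hD0 K le_rfl) (hden K).le
  simp only [hΦ] at h1
  linarith

end MirrorDescent

end DMDP

/-! ### High-probability guarantee and sample counts -/

section Complexity

/-- The distribution mismatch bounds the ratio of the two distributions. -/
lemma le_mismatch_mul {S : Type u} {p q : S → ℝ} (hq : ∀ s, 0 ≤ q s) (hfin : mismatch p q ≠ ⊤)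
    (s : S) : p s ≤ (mismatch p q).toReal * q s := by
  by_cases h0 : p s = 0 ∧ q s = 0
  · rw [h0.1, h0.2, mul_zero]
  have h1 : ENNReal.ofReal (p s) / ENNReal.ofReal (q s) ≤ mismatch p q := by
    have := le_iSup (fun s => if p s = 0 ∧ q s = 0 then (1 : ℝ≥0∞)
      else ENNReal.ofReal (p s) / ENNReal.ofReal (q s)) s
    simp only [if_neg h0] at this
    unfold mismatch
    convert this
  rw [ENNReal.div_le_iff_le_mul (Or.inr hfin) (Or.inl ENNReal.ofReal_ne_top)] at h1
  have h2 := ENNReal.toReal_mono (ENNReal.mul_ne_top hfin ENNReal.ofReal_ne_top) h1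
  rw [ENNReal.toReal_mul, ENNReal.toReal_ofReal (hq s), ENNReal.toReal_ofReal'] at h2
  exact (le_max_left _ _).trans h2

/-- With batches of size at least `X² / 2 * log (2 K |S| |A| / δ)` all estimates are within
`1 / (X (1 - γ))` of the truncated `Q`-functions, with probability at least `1 - δ`. -/
lemma DMDP.guarantee_of_batch {S : Type u} {A : Type v} [Fintype S] [Fintype A] [Nonempty S]
    [Nonempty A] (m : DMDP S A) (hγ : 0 < m.γ) {ρ : S → ℝ} (hρ : ρ ∈ stdSimplex ℝ S)
    {πs π₀ : S → A → ℝ} (hopt : m.IsOptimal πs) {θ : ℝ} (hθ : 1 / (1 - m.γ) ≤ θ)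
    (hmis : ∀ s, m.visitw ρ πs s ≤ θ * ((1 - m.γ) * ρ s)) {h : (A → ℝ) → ℝ} {Z : Set (A → ℝ)}
    (hL : IsLegendre h Z) (hsZ : stdSimplex ℝ A ⊆ Z)
    (hne : (interior Z ∩ stdSimplex ℝ A).Nonempty) {η : ℕ → ℝ} (hη0 : 0 < η 0)
    (hπ₀ : π₀ ∈ policiesInterior S A)
    (hη : (1 - m.γ) / m.γ * bregmanw h (m.visitw ρ πs) πs π₀ ≤ η 0)
    (hηs : ∀ k, 1 / m.γ * η k ≤ η (k + 1)) {δ : ℝ} (hδ : 0 < δ) (hδ1 : δ < 1) {X : ℝ} (hX : 0 < X)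
    {K H : ℕ} {M : ℕ → ℕ} (hK : 0 < K) (hH : 0 < H)
    (hM : ∀ k < K, X ^ 2 / 2 * Real.log (2 * K * Fintype.card S * Fintype.card A / δ) ≤ M k)
    {b : ℝ} (hb : (1 - 1 / θ) ^ K * (2 / (1 - m.γ))
      + 4 * θ * (m.γ ^ H / (1 - m.γ) + 1 / (X * (1 - m.γ))) / (1 - m.γ) ≤ b) :
    DMDP.Guarantee.{u, v, w} m h η π₀ ρ K H M δ b := by
  intro Ω mΩ μ _ ℱ T π hrun
  have hg : 0 < 1 - m.γ := sub_pos.2 m.γ_lt_one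
  set n : ℝ := K * Fintype.card S * Fintype.card A with hn
  have hcS : (1 : ℝ) ≤ Fintype.card S := Nat.one_le_cast.2 Fintype.card_pos
  have hcA : (1 : ℝ) ≤ Fintype.card A := Nat.one_le_cast.2 Fintype.card_pos
  have hKr : (1 : ℝ) ≤ K := Nat.one_le_cast.2 hK
  have hn1 : 1 ≤ n := one_le_mul_of_one_le_of_one_le
    (one_le_mul_of_one_le_of_one_le hKr hcS) hcA
  have hn2 : 2 * K * Fintype.card S * Fintype.card A / δ = 2 * n / δ := by rw [hn]; ring
  rw [hn2] at hM
  have hlog : 0 < Real.log (2 * n / δ) := by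
    refine Real.log_pos ?_
    rw [lt_div_iff₀ hδ]
    linarith
  have hpol : ∀ k ≤ K, ∀ ω, π k ω ∈ policies S A := by
    intro k hk ω
    cases k with
    | zero => rw [hrun.init ω]; exact hπ₀.1
    | succ k => exact fun s => hrun.step_mem k hk ω s
  -- Returns lie in an interval of length `1/(1-γ)`, so this `t` gives the Hoeffding exponent `2 M /
  -- X²`.
  set t : ℝ := 1 / (X * (1 - m.γ)) with ht
  have ht0 : 0 < t := by positivity
  set bad : Fin K × S × A → Set Ω := fun j =>
    {ω | t < |1 / (M j.1 : ℝ) * ∑ i, m.pathReturn (T j.1 j.2.1 j.2.2 i ω)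
      - ∑ τ, m.pathProb (π j.1 ω) (startPair j.2.1 j.2.2) τ * m.pathReturn τ|} with hbad
  have hbadP : ∀ j, μ.real (bad j) ≤ δ / n := by
    rintro ⟨⟨k, hk⟩, s, a⟩
    have hMk := hM k hk
    have hMpos : 0 < M k := by
      have : (0 : ℝ) < M k := lt_of_lt_of_le (by positivity) hMk
      exact_mod_cast this
    refine (measureReal_deviation_le (ℱ.le k) μ hMpos
      (fun i τ => ℱ.le (k + 1) _ (hrun.batch_adapted k hk s a i τ)) (fun τ => ?_)
      (fun ω => ⟨fun τ => m.pathProb_nonneg (hpol k hk.le ω) s a τ,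
        m.sum_pathProb (hpol k hk.le ω) s a hH⟩)
      (hrun.batch_law k hk s a) (one_div_pos.2 hg) ht0.le m.pathReturn_mem).trans ?_
    · exact @DMDP.measurable_pathProb S A _ _ Ω (ℱ k) m _ (hrun.policy_adapted k hk.le) s a H τ
    · have h1 : 2 * (M k : ℝ) * t ^ 2 / (1 / (1 - m.γ)) ^ 2 = 2 * M k / X ^ 2 := by
        rw [ht]; field_simp
      have h2 : Real.log (2 * n / δ) ≤ 2 * M k / X ^ 2 := by
        rw [le_div_iff₀ (by positivity)]; linarith
      rw [h1]
      calc 2 * Real.exp (-(2 * M k / X ^ 2))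
          ≤ 2 * Real.exp (-Real.log (2 * n / δ)) := by gcongr
        _ = δ / n := by
          rw [Real.exp_neg, Real.exp_log (by positivity)]
          field_simp
  have hU : μ.real (⋃ j, bad j) ≤ δ := by
    refine (measureReal_iUnion_fintype_le _).trans ?_
    calc ∑ j, μ.real (bad j) ≤ ∑ _j : Fin K × S × A, δ / n := Finset.sum_le_sum fun j _ => hbadP j
      _ = n * (δ / n) := by simp [hn, mul_assoc]
      _ = δ := by field_simp
  -- Covering the whole space lets subadditivity conclude without measurability of the good event.
  have hgood : univ ⊆ {ω | m.Vw ρ (π K ω) - m.VwOpt ρ ≤ b} ∪ ⋃ j, bad j := by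
    intro ω _
    by_cases hω : ω ∈ ⋃ j, bad j
    · exact Or.inr hω
    refine Or.inl ?_
    rw [mem_ofPred_eq, m.VwOpt_eq hopt hρ]
    refine le_trans ?_ hb
    refine m.inexact_pmd_bound hγ hρ hopt.1 hθ hmis hL hsZ hne hη0 (x := fun k => π k ω)
      (q := fun k s a => m.qHat fun i => T k s a i ω) ?_ ?_ hηs (by positivity) ?_
      (fun k hk s => hrun.step_mem k hk ω s) (fun k hk s => hrun.step_min k hk ω s)
    · simpa only [hrun.init ω] using hπ₀
    · simpa only [hrun.init ω] using hη
    · intro k hk s a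
      have h1 : ω ∉ bad (⟨k, hk⟩, s, a) := fun h' => hω (mem_iUnion.2 ⟨_, h'⟩)
      simp only [hbad, mem_ofPred_eq, not_lt] at h1
      rw [m.sum_pathProb_mul_pathReturn (hpol k hk.le ω)] at h1
      have h2 := m.abs_QTrunc_sub_Q_le (hpol k hk.le ω) H s a
      have h3 := abs_sub_le (m.qHat fun i => T k s a i ω) (m.QTrunc H (π k ω) s a)
        (m.Q (π k ω) s a)
      have h4 : |(m.qHat fun i => T k s a i ω) - m.QTrunc H (π k ω) s a| ≤ t := h1
      linarith
  have h1 := (measureReal_mono (μ := μ) hgood).trans (measureReal_union_le _ _)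
  rw [probReal_univ] at h1
  linarith

lemma pow_one_sub_inv_le {θ y : ℝ} (hθ : 1 ≤ θ) (hy : 0 < y) {K : ℕ}
    (hK : θ * Real.log y ≤ K) : (1 - 1 / θ) ^ K ≤ 1 / y := by
  have hθ0 : 0 < θ := one_pos.trans_le hθ
  have h1 : 1 - 1 / θ ≤ Real.exp (-(1 / θ)) := by
    have := Real.add_one_le_exp (-(1 / θ)); linarith
  have h0 : 0 ≤ 1 - 1 / θ := by rw [sub_nonneg, div_le_one hθ0]; exact hθ
  calc (1 - 1 / θ) ^ K ≤ Real.exp (-(1 / θ)) ^ K := pow_le_pow_left₀ h0 h1 K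
    _ = Real.exp (-(K / θ)) := by rw [← Real.exp_nat_mul]; congr 1; ring
    _ ≤ Real.exp (-Real.log y) := by
      refine Real.exp_le_exp.2 (neg_le_neg ?_)
      rw [le_div_iff₀ hθ0]; linarith
    _ = 1 / y := by rw [Real.exp_neg, Real.exp_log hy, one_div]

lemma pow_le_one_div {γ Y : ℝ} (hγ : 0 < γ) (hY : 0 < Y) {H : ℕ}
    (hH : Real.log Y ≤ H * Real.log (1 / γ)) : γ ^ H ≤ 1 / Y := by
  refine (Real.log_le_log_iff (by positivity) (by positivity)).1 ?_
  rw [Real.log_pow, one_div, Real.log_inv]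
  rw [one_div, Real.log_inv] at hH
  linarith

/-- A horizon counted in units of `1/(1-γ)` is thus long enough, although `γ ^ H` decays at rate
`log (1/γ)`. -/
lemma one_sub_le_log_one_div {γ : ℝ} (hγ : 0 < γ) : 1 - γ ≤ Real.log (1 / γ) := by
  rw [one_div, Real.log_inv]
  linarith [Real.log_le_sub_one_of_pos hγ]

/-- The error bound is at most `ε` for sufficiently large numbers of iterations and horizons. -/
lemma error_le {g θ ε X p y : ℝ} (hg : 0 < g) (hθ : 0 < θ) (hε : 0 < ε) (hX : 0 < X)
    (hp : p ≤ 1 / (4 / (g * ε))) (hy : y ≤ 1 / (16 * θ / (g ^ 2 * ε)))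
    (hXY : 1 / X ≤ 1 / (16 * θ / (g ^ 2 * ε))) :
    p * (2 / g) + 4 * θ * (y / g + 1 / (X * g)) / g ≤ ε := by
  rw [one_div_div] at hp hy hXY
  have h1 : p * (2 / g) ≤ ε / 2 := by
    calc p * (2 / g) ≤ g * ε / 4 * (2 / g) := by gcongr
      _ = ε / 2 := by field_simp; norm_num
  -- Truncation bias and sampling error contribute `ε / 4` each; the contraction contributed `ε /
  -- 2`.
  have h2 : 4 * θ * (y / g + 1 / (X * g)) / g ≤ ε / 2 := by
    calc 4 * θ * (y / g + 1 / (X * g)) / g = 4 * θ * (y + 1 / X) / g ^ 2 := by field_simp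
      _ ≤ 4 * θ * (g ^ 2 * ε / (16 * θ) + g ^ 2 * ε / (16 * θ)) / g ^ 2 := by gcongr
      _ = ε / 2 := by field_simp; norm_num
  linarith

/-- The number of samples in terms of the accuracy, with all logarithmic factors bounded by
powers of their sum. -/
lemma sample_count_le {g C θ ε δ n κ : ℝ} (hg : 0 < g) (hg1 : g ≤ 1) (hC : 1 ≤ C)
    (hθ : θ = 1 / g * C) (hε : 0 < ε) (hεg : ε ≤ 1 / g) (hδ : 0 < δ) (hδ1 : δ < 1) (hn : 1 ≤ n)
    (hκ : 1 ≤ κ) {K H N : ℕ} (hK : K = ⌈θ * Real.log (4 / (g * ε))⌉₊)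
    (hH : (H : ℝ) ≤ 1 / g * Real.log (16 * θ / (g ^ 2 * ε)) + 1)
    (hN : (N : ℝ) ≤ κ * (16 * θ / (g ^ 2 * ε)) ^ 2 / 2 * Real.log (2 * K * n / δ) + 1) :
    K * (n * N * H) ≤ κ * (9216 * (n / (g ^ 8 * ε ^ 2) * C ^ 3)
      * (1 + Real.log (1 / g) + max (Real.log (1 / ε)) 0 + Real.log (n / δ) + Real.log C) ^ 3) := by
  set L1 := Real.log (1 / g) with hL1
  set L2 := max (Real.log (1 / ε)) 0 with hL2
  set L3 := Real.log (n / δ) with hL3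
  set L4 := Real.log C with hL4
  set Λ := 1 + L1 + L2 + L3 + L4 with hΛ
  have hC0 : 0 < C := by linarith
  have h1g : 1 ≤ 1 / g := by rw [le_div_iff₀ hg]; linarith
  have hL1' : 0 ≤ L1 := Real.log_nonneg h1g
  have hL2' : 0 ≤ L2 := le_max_right _ _
  have hL2'' : Real.log (1 / ε) ≤ L2 := le_max_left _ _
  have hL3' : 0 ≤ L3 := Real.log_nonneg (by rw [le_div_iff₀ hδ]; linarith)
  have hL4' : 0 ≤ L4 := Real.log_nonneg hC
  have hΛ1 : 1 ≤ Λ := by linarith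
  have hθ1 : 1 ≤ θ := by rw [hθ]; exact one_le_mul_of_one_le_of_one_le h1g hC
  have hθ0 : 0 < θ := by linarith
  set Y := 16 * θ / (g ^ 2 * ε) with hY
  have hgε : g * ε ≤ 1 := by rw [le_div_iff₀ hg] at hεg; linarith
  have hY1 : 1 ≤ Y := by
    rw [hY, le_div_iff₀ (by positivity)]
    nlinarith
  have hlog2 := Real.log_two_lt_d9
  have hlog4 : Real.log 4 ≤ 1.4 := by
    rw [show (4 : ℝ) = 2 ^ 2 by norm_num, Real.log_pow]; push_cast; linarith
  have hlog16 : Real.log 16 ≤ 3 := by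
    rw [show (16 : ℝ) = 2 ^ 4 by norm_num, Real.log_pow]; push_cast; linarith
  have hlog6 : Real.log 6 ≤ 2.1 := by
    refine (Real.log_le_log (by norm_num) (show (6 : ℝ) ≤ 2 ^ 3 by norm_num)).trans ?_
    rw [Real.log_pow]; push_cast; linarith
  have hlogY : Real.log Y ≤ 3 * Λ := by
    have h1 : Y = 16 * (C * ((1 / g) ^ 3 * (1 / ε))) := by rw [hY, hθ]; field_simp
    rw [h1, Real.log_mul (by norm_num) (by positivity), Real.log_mul hC0.ne' (by positivity),
      Real.log_mul (by positivity) (by positivity), Real.log_pow]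
    push_cast
    linarith
  have hlogK : Real.log (4 / (g * ε)) ≤ 2 * Λ := by
    have h1 : 4 / (g * ε) = 4 * ((1 / g) * (1 / ε)) := by field_simp
    rw [h1, Real.log_mul (by norm_num) (by positivity),
      Real.log_mul (by positivity) (by positivity)]
    linarith
  have hlogK0 : 0 < Real.log (4 / (g * ε)) := by
    refine Real.log_pos ?_
    rw [lt_div_iff₀ (by positivity)]; linarith
  have hK0 : 0 < K := by rw [hK]; exact Nat.ceil_pos.2 (mul_pos hθ0 hlogK0)
  have hKr : (1 : ℝ) ≤ K := Nat.one_le_cast.2 hK0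
  have hθΛ : 1 ≤ θ * Λ := one_le_mul_of_one_le_of_one_le hθ1 hΛ1
  have hKb : (K : ℝ) ≤ 3 * (θ * Λ) := by
    have h1 := (Nat.ceil_lt_add_one (mul_pos hθ0 hlogK0).le).le
    rw [← hK] at h1
    have h2 := mul_le_mul_of_nonneg_left hlogK hθ0.le
    linarith
  have hHb : (H : ℝ) ≤ 4 * (1 / g * Λ) := by
    have h1 : 1 ≤ 1 / g * Λ := one_le_mul_of_one_le_of_one_le h1g hΛ1
    have h2 := mul_le_mul_of_nonneg_left hlogY (one_div_pos.2 hg).le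
    linarith
  have hlogN : Real.log (2 * K * n / δ) ≤ 2 * Λ + 1 := by
    have h1 : 2 * K * n / δ = (2 * K) * (n / δ) := by ring
    have h2 : Real.log (2 * K) ≤ Real.log (6 * ((1 / g) * (C * Λ))) := by
      refine Real.log_le_log (by positivity) ?_
      rw [hθ] at hKb
      linarith
    rw [Real.log_mul (x := 6) (by norm_num) (by positivity),
      Real.log_mul (x := 1 / g) (by positivity) (by positivity),
      Real.log_mul hC0.ne' (by positivity)] at h2
    -- The bound on `K` contains `Λ`, so a term `log Λ` appears; `log Λ ≤ Λ - 1` keeps everything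
    -- linear in `Λ`.
    have h3 := Real.log_le_sub_one_of_pos (one_pos.trans_le hΛ1)
    rw [h1, Real.log_mul (by positivity) (by positivity)]
    linarith
  have hNb : (N : ℝ) ≤ 3 * (κ * Y ^ 2 * Λ) := by
    have hκY : 1 ≤ κ * Y ^ 2 := one_le_mul_of_one_le_of_one_le hκ (one_le_pow₀ hY1)
    have h1 := mul_le_mul_of_nonneg_left hlogN (by positivity : 0 ≤ κ * Y ^ 2 / 2)
    have h2 : κ * Y ^ 2 ≤ κ * Y ^ 2 * Λ := le_mul_of_one_le_right (by positivity) hΛ1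
    linarith
  -- Powers of `1/g`: one from `θ` in `K`, one from `H`, six from `Y²`. Powers of `C`: one from `K`,
  -- two from `Y²`.
  calc K * (n * N * H)
      ≤ 3 * (θ * Λ) * (n * (3 * (κ * Y ^ 2 * Λ)) * (4 * (1 / g * Λ))) := by
        gcongr
    _ = κ * (9216 * (n / (g ^ 8 * ε ^ 2) * C ^ 3) * Λ ^ 3) := by
        rw [hY, hθ]
        field_simp
        ring

end Complexity

/-! ### Assembly of the bounds -/

theorem mainTheorem3 :
    ∃ (c : ℝ) (p : ℕ), 0 < c ∧
    ∀ (S : Type u) (A : Type v) [Fintype S] [Fintype A] (m : DMDP S A) (ρ : S → ℝ)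
      (πopt π₀ : S → A → ℝ) (h : (A → ℝ) → ℝ) (Z : Set (A → ℝ)) (η : ℕ → ℝ) (C θ : ℝ),
      0 < m.γ →
      ρ ∈ stdSimplex ℝ S →
      m.IsOptimal πopt →
      mismatch (m.visitw ρ πopt) ρ ≠ ⊤ →
      C = (mismatch (m.visitw ρ πopt) ρ).toReal →
      θ = 1 / (1 - m.γ) * C →
      IsLegendre h Z →
      stdSimplex ℝ A ⊆ Z →
      (interior Z ∩ stdSimplex ℝ A).Nonempty →
      π₀ ∈ policiesInterior S A →
      0 < η 0 →
      (1 - m.γ) / m.γ * bregmanw h (m.visitw ρ πopt) πopt π₀ ≤ η 0 →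
      (∀ k, 1 / m.γ * η k ≤ η (k + 1)) →
      ∀ δ : ℝ, 0 < δ → δ < 1 →
        -- the high-probability bound
        (∀ (K H : ℕ) (M : ℕ → ℕ), 0 < K → 0 < H →
          (∀ k < K, (m.γ ^ (2 * H))⁻¹ / 2
            * Real.log (2 * K * Fintype.card S * Fintype.card A / δ) ≤ M k) →
          DMDP.Guarantee.{u, v, w} m h η π₀ ρ K H M δ
            ((1 - 1 / θ) ^ K * (2 / (1 - m.γ)) + 8 * θ / (1 - m.γ) ^ 2 * m.γ ^ H)) ∧
        -- sufficient sizes of `K` and `H` for accuracy `ε`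
        (∀ (ε : ℝ) (K H : ℕ) (M : ℕ → ℕ), 0 < ε → 0 < K → 0 < H →
          (∀ k < K, (m.γ ^ (2 * H))⁻¹ / 2
            * Real.log (2 * K * Fintype.card S * Fintype.card A / δ) ≤ M k) →
          θ * Real.log (4 / ((1 - m.γ) * ε)) ≤ K →
          1 / (1 - m.γ) * Real.log (16 * θ / ((1 - m.γ) ^ 2 * ε)) ≤ H →
          DMDP.Guarantee.{u, v, w} m h η π₀ ρ K H M δ ε) ∧
        -- sample complexity with the least `K` and `H` as above
        (∀ (ε : ℝ) (K H N : ℕ), 0 < ε → ε ≤ 1 / (1 - m.γ) →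
          K = ⌈θ * Real.log (4 / ((1 - m.γ) * ε))⌉₊ →
          H = ⌈1 / (1 - m.γ) * Real.log (16 * θ / ((1 - m.γ) ^ 2 * ε))⌉₊ →
          N = ⌈1 / 2 * (16 * θ / ((1 - m.γ) ^ 2 * ε)) ^ 2
            * Real.log (2 * K * Fintype.card S * Fintype.card A / δ)⌉₊ →
          DMDP.Guarantee.{u, v, w} m h η π₀ ρ K H (fun _ => N) δ ε ∧
          (sampleCount S A K H (fun _ => N) : ℝ)
            ≤ c * (Fintype.card S * Fintype.card A / ((1 - m.γ) ^ 8 * ε ^ 2) * C ^ 3)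
              * (1 + Real.log (1 / (1 - m.γ)) + max (Real.log (1 / ε)) 0
                + Real.log (Fintype.card S * Fintype.card A / δ) + Real.log C) ^ p) ∧
        -- sample complexity with batch sizes as in the high-probability bound
        (∀ (ε : ℝ) (K H N : ℕ), 0 < ε → ε ≤ 1 / (1 - m.γ) →
          K = ⌈θ * Real.log (4 / ((1 - m.γ) * ε))⌉₊ →
          H = ⌈1 / Real.log (1 / m.γ) * Real.log (16 * θ / ((1 - m.γ) ^ 2 * ε))⌉₊ →
          N = ⌈(m.γ ^ (2 * H))⁻¹ / 2
            * Real.log (2 * K * Fintype.card S * Fintype.card A / δ)⌉₊ →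
          DMDP.Guarantee.{u, v, w} m h η π₀ ρ K H (fun _ => N) δ ε ∧
          (sampleCount S A K H (fun _ => N) : ℝ)
            ≤ c / m.γ ^ 2 * (Fintype.card S * Fintype.card A / ((1 - m.γ) ^ 8 * ε ^ 2) * C ^ 3)
              * (1 + Real.log (1 / (1 - m.γ)) + max (Real.log (1 / ε)) 0
                + Real.log (Fintype.card S * Fintype.card A / δ) + Real.log C) ^ p) := by
  -- `9216 = 3 · 3 · 4 · 16²`, from the bounds on `K`, `N`, `H` and the `16` in `Y`; each of the
  -- three counts carries one factor `Λ`.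
  refine ⟨9216, 3, by norm_num, ?_⟩
  intro S A _ _ m ρ πopt π₀ h Z η C θ hγ hρ hopt hfin hC hθ hL hsZ hne hπ₀ hη0 hη hηs δ hδ hδ1
  have : Nonempty S := by
    by_contra hS
    rw [not_nonempty_iff] at hS
    simpa using hρ.2
  have : Nonempty A := by
    by_contra hA
    rw [not_nonempty_iff] at hA
    simpa using (hπ₀.1 (Classical.arbitrary S)).2
  have hg : 0 < 1 - m.γ := sub_pos.2 m.γ_lt_one
  have hg1 : 1 - m.γ ≤ 1 := by linarith
  have hmisC : ∀ s, m.visitw ρ πopt s ≤ C * ρ s := by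
    rw [hC]; exact le_mismatch_mul hρ.1 hfin
  -- Both `d_ρ(π⋆)` and `ρ` have total mass one.
  have hC1 : 1 ≤ C := by
    have h1 := Finset.sum_le_sum fun s (_ : s ∈ Finset.univ) => hmisC s
    rwa [m.sum_visitw hopt.1 hρ, ← Finset.mul_sum, hρ.2, mul_one] at h1
  have hC0 : 0 < C := one_pos.trans_le hC1
  have hθg : 1 / (1 - m.γ) ≤ θ := by
    rw [hθ]; exact le_mul_of_one_le_right (one_div_pos.2 hg).le hC1
  have hθ1 : 1 ≤ θ := le_trans (by rw [le_div_iff₀ hg]; linarith) hθg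
  have hθ0 : 0 < θ := one_pos.trans_le hθ1
  have hmis : ∀ s, m.visitw ρ πopt s ≤ θ * ((1 - m.γ) * ρ s) := by
    intro s
    refine (hmisC s).trans (le_of_eq ?_)
    rw [hθ]; field_simp
  have hl := one_sub_le_log_one_div hγ
  have hl0 : 0 < Real.log (1 / m.γ) := hg.trans_le hl
  have hinv : ∀ H : ℕ, ((m.γ ^ H)⁻¹) ^ 2 = (m.γ ^ (2 * H))⁻¹ := fun H => by
    rw [inv_pow, ← pow_mul, mul_comm]
  have hbase : ∀ {X : ℝ}, 0 < X → ∀ {K H : ℕ} {M : ℕ → ℕ}, 0 < K → 0 < H →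
      (∀ k < K, X ^ 2 / 2
        * Real.log (2 * K * Fintype.card S * Fintype.card A / δ) ≤ M k) → ∀ {b : ℝ},
      (1 - 1 / θ) ^ K * (2 / (1 - m.γ))
        + 4 * θ * (m.γ ^ H / (1 - m.γ) + 1 / (X * (1 - m.γ))) / (1 - m.γ) ≤ b →
      DMDP.Guarantee.{u, v, w} m h η π₀ ρ K H M δ b := fun hX _ _ _ hK hH hM _ hb =>
    m.guarantee_of_batch hγ hρ hopt hθg hmis hL hsZ hne hη0 hπ₀ hη hηs hδ hδ1 hX hK hH hM hb
  have hmain : ∀ {ε X : ℝ} {K H : ℕ} {M : ℕ → ℕ}, 0 < ε → 0 < X → 0 < K → 0 < H →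
      (∀ k < K, X ^ 2 / 2
        * Real.log (2 * K * Fintype.card S * Fintype.card A / δ) ≤ M k) →
      θ * Real.log (4 / ((1 - m.γ) * ε)) ≤ K →
      Real.log (16 * θ / ((1 - m.γ) ^ 2 * ε)) ≤ H * Real.log (1 / m.γ) →
      1 / X ≤ 1 / (16 * θ / ((1 - m.γ) ^ 2 * ε)) →
      DMDP.Guarantee.{u, v, w} m h η π₀ ρ K H M δ ε := by
    intro ε X K H M hε hX hK hH hM hKl hHl hXY
    exact hbase hX hK hH hM (error_le hg hθ0 hε hX
      (pow_one_sub_inv_le hθ1 (by positivity) hKl) (pow_le_one_div hγ (by positivity) hHl) hXY)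
  have hY : ∀ {ε : ℝ}, 0 < ε → ε ≤ 1 / (1 - m.γ) →
      1 < 16 * θ / ((1 - m.γ) ^ 2 * ε) ∧ 0 < θ * Real.log (4 / ((1 - m.γ) * ε)) := by
    intro ε hε hεg
    have h1 : (1 - m.γ) * ε ≤ 1 := by rw [le_div_iff₀ hg] at hεg; linarith
    have h2 : 0 < (1 - m.γ) * ε := by positivity
    refine ⟨?_, mul_pos hθ0 (Real.log_pos ?_)⟩
    · rw [lt_div_iff₀ (by positivity)]
      nlinarith
    · rw [lt_div_iff₀ h2]; linarith
  have hn1 : (1 : ℝ) ≤ Fintype.card S * Fintype.card A :=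
    one_le_mul_of_one_le_of_one_le (Nat.one_le_cast.2 Fintype.card_pos)
      (Nat.one_le_cast.2 Fintype.card_pos)
  have hlogN : ∀ {K : ℕ}, 0 < K →
      0 < Real.log (2 * K * Fintype.card S * Fintype.card A / δ) := by
    intro K hK
    have hK' : (1 : ℝ) ≤ K := Nat.one_le_cast.2 hK
    have h1 := one_le_mul_of_one_le_of_one_le hK' hn1
    refine Real.log_pos ?_
    rw [lt_div_iff₀ hδ]
    linarith
  have hcount : ∀ K H N : ℕ, (sampleCount S A K H (fun _ => N) : ℝ)
      = K * ((Fintype.card S * Fintype.card A : ℝ) * N * H) := by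
    intro K H N
    simp [sampleCount]
  refine ⟨?_, ?_, ?_, ?_⟩
  · intro K H M hK hH hM
    -- With this `X` the sampling error equals the truncation bound, which doubles `4θ` to `8θ`.
    refine hbase (X := (m.γ ^ H)⁻¹) (by positivity) hK hH (by simpa only [hinv] using hM)
      (le_of_eq ?_)
    field_simp
    ring
  · intro ε K H M hε hK hH hM hKl hHl
    have h1 : Real.log (16 * θ / ((1 - m.γ) ^ 2 * ε)) ≤ H * Real.log (1 / m.γ) := by
      rw [one_div_mul_eq_div, div_le_iff₀ hg] at hHl
      exact hHl.trans (mul_le_mul_of_nonneg_left hl (Nat.cast_nonneg H))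
    refine hmain hε (X := (m.γ ^ H)⁻¹) (by positivity) hK hH (by simpa only [hinv] using hM)
      hKl h1 ?_
    rw [one_div, inv_inv]
    exact pow_le_one_div hγ (by positivity) h1
  · intro ε K H N hε hεg hK hH hN
    obtain ⟨hY1, hKp⟩ := hY hε hεg
    have hK0 : 0 < K := by rw [hK]; exact Nat.ceil_pos.2 hKp
    have hHp := mul_pos (one_div_pos.2 hg) (Real.log_pos hY1)
    have hH0 : 0 < H := by rw [hH]; exact Nat.ceil_pos.2 hHp
    have hKl : θ * Real.log (4 / ((1 - m.γ) * ε)) ≤ K := by rw [hK]; exact Nat.le_ceil _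
    have hHl : 1 / (1 - m.γ) * Real.log (16 * θ / ((1 - m.γ) ^ 2 * ε)) ≤ H := by
      rw [hH]; exact Nat.le_ceil _
    have hNl := Nat.le_ceil (1 / 2 * (16 * θ / ((1 - m.γ) ^ 2 * ε)) ^ 2
      * Real.log (2 * K * Fintype.card S * Fintype.card A / δ))
    have hNu := (Nat.ceil_lt_add_one (a := 1 / 2 * (16 * θ / ((1 - m.γ) ^ 2 * ε)) ^ 2
      * Real.log (2 * K * Fintype.card S * Fintype.card A / δ))
      (mul_nonneg (by positivity) (hlogN hK0).le)).le
    rw [← hN] at hNl hNu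
    refine ⟨hmain hε (one_pos.trans hY1) hK0 hH0 (fun k _ => ?_) hKl ?_ le_rfl, ?_⟩
    · rwa [one_div_mul_eq_div] at hNl
    · rw [one_div_mul_eq_div, div_le_iff₀ hg] at hHl
      exact hHl.trans (mul_le_mul_of_nonneg_left hl (Nat.cast_nonneg H))
    · rw [hcount]
      have h1 := sample_count_le hg hg1 hC1 hθ hε hεg hδ hδ1 hn1 le_rfl hK (H := H)
        (by rw [hH]; exact (Nat.ceil_lt_add_one hHp.le).le) (N := N)
        (by rw [one_mul, ← mul_assoc (2 * (K : ℝ)), ← one_div_mul_eq_div]; exact hNu)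
      rwa [one_mul] at h1
  · intro ε K H N hε hεg hK hH hN
    obtain ⟨hY1, hKp⟩ := hY hε hεg
    have hY0 := one_pos.trans hY1
    have hK0 : 0 < K := by rw [hK]; exact Nat.ceil_pos.2 hKp
    have hHp := mul_pos (one_div_pos.2 hl0) (Real.log_pos hY1)
    have hH0 : 0 < H := by rw [hH]; exact Nat.ceil_pos.2 hHp
    have hKl : θ * Real.log (4 / ((1 - m.γ) * ε)) ≤ K := by rw [hK]; exact Nat.le_ceil _
    have hHl : Real.log (16 * θ / ((1 - m.γ) ^ 2 * ε)) ≤ H * Real.log (1 / m.γ) := by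
      rw [← div_le_iff₀ hl0, ← one_div_mul_eq_div, hH]; exact Nat.le_ceil _
    have hHu : (H : ℝ) ≤ 1 / Real.log (1 / m.γ) * Real.log (16 * θ / ((1 - m.γ) ^ 2 * ε)) + 1 := by
      rw [hH]; exact (Nat.ceil_lt_add_one hHp.le).le
    have hNl := Nat.le_ceil ((m.γ ^ (2 * H))⁻¹ / 2
      * Real.log (2 * K * Fintype.card S * Fintype.card A / δ))
    have hNu := (Nat.ceil_lt_add_one (a := (m.γ ^ (2 * H))⁻¹ / 2
      * Real.log (2 * K * Fintype.card S * Fintype.card A / δ))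
      (mul_nonneg (by positivity) (hlogN hK0).le)).le
    rw [← hN] at hNl hNu
    refine ⟨hmain hε (X := (m.γ ^ H)⁻¹) (by positivity) hK0 hH0 (fun k _ => ?_) hKl hHl ?_, ?_⟩
    · rwa [hinv]
    · rw [one_div, inv_inv]
      exact pow_le_one_div hγ hY0 hHl
    -- Rounding `H` up overshoots by at most one step, costing a factor `1/γ` here and `1/γ²` in the
    -- batch size; hence `κ = 1/γ²`.
    · have h1 : (m.γ ^ H)⁻¹ ≤ 16 * θ / ((1 - m.γ) ^ 2 * ε) / m.γ := by
        refine (Real.log_le_log_iff (by positivity) (by positivity)).1 ?_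
        rw [Real.log_inv, Real.log_pow, Real.log_div hY0.ne' hγ.ne']
        have h2 : H * Real.log (1 / m.γ)
            ≤ Real.log (16 * θ / ((1 - m.γ) ^ 2 * ε)) + Real.log (1 / m.γ) := by
          have h3 := mul_le_mul_of_nonneg_right hHu hl0.le
          have h4 : (1 / Real.log (1 / m.γ) * Real.log (16 * θ / ((1 - m.γ) ^ 2 * ε)) + 1)
              * Real.log (1 / m.γ)
              = Real.log (16 * θ / ((1 - m.γ) ^ 2 * ε)) + Real.log (1 / m.γ) := by
            field_simp
          rwa [h4] at h3
        rw [one_div, Real.log_inv] at h2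
        linarith
      have h5 : (m.γ ^ (2 * H))⁻¹ ≤ 1 / m.γ ^ 2 * (16 * θ / ((1 - m.γ) ^ 2 * ε)) ^ 2 := by
        rw [← hinv]
        refine (pow_le_pow_left₀ (by positivity) h1 2).trans (le_of_eq ?_)
        rw [div_pow _ m.γ]; ring
      have h6 : (H : ℝ) ≤ 1 / (1 - m.γ) * Real.log (16 * θ / ((1 - m.γ) ^ 2 * ε)) + 1 := by
        refine hHu.trans (by gcongr; exact (Real.log_pos hY1).le)
      have h7 := sample_count_le hg hg1 hC1 hθ hε hεg hδ hδ1 hn1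
        (one_le_one_div (by positivity) (pow_le_one₀ hγ.le m.γ_lt_one.le) : 1 ≤ 1 / m.γ ^ 2)
        hK h6 (N := N) (by
          rw [← mul_assoc (2 * (K : ℝ))]
          refine hNu.trans ?_
          have := (hlogN hK0).le
          gcongr)
      rw [hcount]
      refine h7.trans (le_of_eq ?_)
      ring
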